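/- Let $X(t)$, $t\ge 0$, be a time-homogeneous continuous-time Markov chain with right-continuous paths on $\{1,\dots,K\}$, $K\ge 1$, with irreducible generator $Q=(q_{ij})$ and an arbitrary initial distribution. Let $\pi$ be its stationary distribution ($\pi Q=0$, $\sum_i\pi_i=1$) and suppose that the chain is time-reversible: $\pi_i q_{ij}=\pi_j q_{ji}$ for $i\ne j$. Put $\Pi=\mathrm{diag}(\pi_1,\dots,\pi_K)$ and $S=\Pi^{1/2}Q\Pi^{-1/2}$. Let $U$ be an orthogonal matrix with $U^{T}SU=\mathrm{diag}(-d_1,\dots,-d_{K-1},0)$, and put $T=\Pi^{-1/2}U=(t_{ij})$ and $\tilde T=T^{-1}$. Let $P=(p_{ij})$ be a proximity matrix, that is, $0\le p_{ij}\le 1$ and $p_{ii}=1$; $P(:,i)$ denotes its $i$th column and $\tilde T(j,:)$ the $j$th row of $\tilde T$. For $\lambda>0$ let $X$ be sampled at time $0$ and at the points of a Poisson process of rate $\lambda$ that is independent of $X$. Let $\tilde X(t)=X(t')$, where $t'$ is the latest sampling time up to $t$. The fresh-when-close freshness process is $F_c(t)=p_{ij}$ when $X(t)=i$ and $\tilde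 X(t)=j$. Then $F_c$ has a mean freshness $f(\lambda)=\mathbb{E}[F_c]$, in the following sense: the law of $F_c(t)$ converges as $t\to\infty$ to a steady-state law with mean $f(\lambda)$, and almost surely $\frac1\tau\int_0^\tau F_c(t)\,dt\to f(\lambda)$ as $\tau\to\infty$. The value $f(\lambda)$ depends only on $Q$, $P$ and $\lambda$. For every $\lambda>0$, $$f(\lambda)=\pi\sum_{i=1}^{K}\pi_iP(:,i)+\sum_{j=1}^{K-1}\frac{b_j\lambda}{\lambda+d_j}=1-\sum_{j=1}^{K-1}\frac{a_j}{\lambda+d_j},$$ where, for $1\le j\le K-1$, $$b_j=\tilde T(j,:)\sum_{i=1}^{K}\pi_i t_{ij}P(:,i),\qquad a_j=b_jd_j,$$ and $\lim_{\lambda\to0^+}f(\lambda)=\pi\sum_{i=1}^{K}\pi_iP(:,i)$. The coefficients $a_j$ and $b_j$ may be negative: there are such $Q$, $U$ and $P$ for which $a_j<0$ and $b_j<0$ for some $j$. -/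

import Mathlib

open MeasureTheory ProbabilityTheory Filter Topology
open scoped NNReal Matrix

namespace Freshness

noncomputable section

/-! ### Generators of finite-state continuous-time Markov chains -/

/-- Infinitesimal generator (rate matrix): nonnegative off-diagonal entries and `Q e = 0`. -/
structure IsGenerator {K : ℕ} (Q : Matrix (Fin K) (Fin K) ℝ) : Prop where
  rate_nonneg : ∀ i j, i ≠ j → 0 ≤ Q i j
  row_sum : ∀ i, ∑ j, Q i j = 0

/-- The matrix `P(t) = exp (t Q)` of transition probabilities over a time span `t`. -/
def transition {K : ℕ} (Q : Matrix (Fin K) (Fin K) ℝ) (t : ℝ) : Matrix (Fin K) (Fin K) ℝ :=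
  NormedSpace.exp (t • Q)

/-- Irreducibility: from any state, any other state is reached with positive probability in some
finite time. -/
def IsIrreducible {K : ℕ} (Q : Matrix (Fin K) (Fin K) ℝ) : Prop :=
  ∀ i j, ∃ t : ℝ, 0 ≤ t ∧ 0 < transition Q t i j

/-- `π` is a stationary distribution: a probability vector with `π Q = 0`. -/
structure IsStationary {K : ℕ} (Q : Matrix (Fin K) (Fin K) ℝ) (π : Fin K → ℝ) : Prop where
  nonneg : ∀ i, 0 ≤ π i
  sum_eq_one : ∑ i, π i = 1
  balance : π ᵥ* Q = 0

/-- Time-reversibility: the detailed balance equations. -/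
def IsTimeReversible {K : ℕ} (Q : Matrix (Fin K) (Fin K) ℝ) (π : Fin K → ℝ) : Prop :=
  ∀ i j, i ≠ j → π i * Q i j = π j * Q j i

/-! ### The processes -/

/-- The process `X` is a time-homogeneous continuous-time Markov chain with generator `Q` (and
arbitrary initial distribution): right-continuous paths and the Markov property with transition
probabilities `exp (t Q)`. -/
structure IsCTMC {Ω : Type*} [MeasurableSpace Ω] (μ : Measure Ω) {K : ℕ}
    (Q : Matrix (Fin K) (Fin K) ℝ) (X : ℝ≥0 → Ω → Fin K) : Prop where
  measurable : ∀ t, Measurable (X t)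
  right_continuous : ∀ ω t, ContinuousWithinAt (fun s => X s ω) (Set.Ici t) t
  markov : ∀ (n : ℕ) (t : ℕ → ℝ≥0) (x : ℕ → Fin K), Monotone t →
    μ.real {ω | ∀ k ≤ n + 1, X (t k) ω = x k} =
      μ.real {ω | ∀ k ≤ n, X (t k) ω = x k} *
        transition Q ((t (n + 1) : ℝ) - t n) (x n) (x (n + 1))

/-- `N` is a homogeneous Poisson (counting) process with intensity `r`. -/
structure IsPoissonProcess {Ω : Type*} [MeasurableSpace Ω] (μ : Measure Ω) (r : ℝ)
    (N : ℝ≥0 → Ω → ℕ) : Prop where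
  measurable : ∀ t, Measurable (N t)
  zero : ∀ ω, N 0 ω = 0
  monotone : ∀ ω, Monotone (fun t => N t ω)
  right_continuous : ∀ ω t, ContinuousWithinAt (fun s => N s ω) (Set.Ici t) t
  indep_increments : HasIndepIncrements N μ
  law_increment : ∀ s t : ℝ≥0, s ≤ t →
    HasLaw (fun ω => N t ω - N s ω) (poissonMeasure (r * ((t : ℝ) - s)).toNNReal) μ

/-- The sampling times: the instant `0`, and the jump times of the counting process `N`. -/
def samplingTimes {Ω : Type*} (N : ℝ≥0 → Ω → ℕ) (ω : Ω) : Set ℝ≥0 :=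
  insert 0 {s | 0 < s ∧ ∀ r < s, N r ω < N s ω}

/-- The latest sampling time up to time `t`. -/
def lastSample {Ω : Type*} (N : ℝ≥0 → Ω → ℕ) (t : ℝ≥0) (ω : Ω) : ℝ≥0 :=
  sSup {s | s ∈ samplingTimes N ω ∧ s ≤ t}

/-- The martingale estimator: the value of `X` at the latest sampling time. -/
def estimator {Ω : Type*} {K : ℕ} (X : ℝ≥0 → Ω → Fin K) (N : ℝ≥0 → Ω → ℕ)
    (t : ℝ≥0) (ω : Ω) : Fin K :=
  X (lastSample N t ω) ω

/-- `X` is a Markov chain with generator `Q`, and `N` an independent Poisson process of queries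
with rate `r`. -/
structure IsPoissonSampledCTMC {Ω : Type*} [MeasurableSpace Ω] (μ : Measure Ω) {K : ℕ}
    (Q : Matrix (Fin K) (Fin K) ℝ) (r : ℝ) (X : ℝ≥0 → Ω → Fin K) (N : ℝ≥0 → Ω → ℕ) : Prop where
  chain : IsCTMC μ Q X
  queries : IsPoissonProcess μ r N
  indep : IndepFun (fun ω t => X t ω) (fun ω t => N t ω) μ

/-! ### Fresh when close -/

/-- Proximity matrix: entries in `[0, 1]`, and `1` on the diagonal. -/
structure IsProximity {K : ℕ} (P : Matrix (Fin K) (Fin K) ℝ) : Prop where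
  nonneg : ∀ i j, 0 ≤ P i j
  le_one : ∀ i j, P i j ≤ 1
  diag : ∀ i, P i i = 1

/-- The fresh-when-close freshness process: `P i j` when the chain is in state `i` and its
estimate is `j`. -/
def fwc {Ω : Type*} {K : ℕ} (P : Matrix (Fin K) (Fin K) ℝ) (X : ℝ≥0 → Ω → Fin K)
    (N : ℝ≥0 → Ω → ℕ) (t : ℝ≥0) (ω : Ω) : ℝ :=
  P (X t ω) (estimator X N t ω)

/-- `m` is the mean of the freshness process `F`: it is the expectation of a random variable
whose law `ν` is the steady-state law of `F`, i.e. the limit of the laws of `F t`, and it is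
almost surely the long-run time average of `F`. -/
structure IsMeanFreshness {Ω : Type*} [MeasurableSpace Ω] (μ : Measure Ω) (F : ℝ≥0 → Ω → ℝ)
    (m : ℝ) : Prop where
  steady_state : ∃ ν : Measure ℝ, IsProbabilityMeasure ν ∧
    (∀ v : ℝ, Tendsto (fun t : ℝ≥0 => μ.real {ω | F t ω = v}) atTop (𝓝 (ν.real {v}))) ∧
    ∫ x, x ∂ν = m
  time_average : ∀ᵐ ω ∂μ,
    Tendsto (fun τ : ℝ => (1 / τ) * ∫ t in (0 : ℝ)..τ, F t.toNNReal ω) atTop (𝓝 m)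

/-! ### Diagonalization of a time-reversible generator -/

/-- `S = Π^{1/2} Q Π^{-1/2}` with `Π = diag π`. -/
def symmetrized {K : ℕ} (Q : Matrix (Fin K) (Fin K) ℝ) (π : Fin K → ℝ) :
    Matrix (Fin K) (Fin K) ℝ :=
  Matrix.diagonal (fun i => √(π i)) * Q * Matrix.diagonal (fun i => (√(π i))⁻¹)

/-- `U` is orthogonal and `Uᵀ S U = diag (-d₁, …, -d_{K-1}, 0)`, where `K = n + 1`. -/
structure IsDiagonalization {n : ℕ} (Q : Matrix (Fin (n + 1)) (Fin (n + 1)) ℝ)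
    (π : Fin (n + 1) → ℝ) (U : Matrix (Fin (n + 1)) (Fin (n + 1)) ℝ) (d : Fin n → ℝ) : Prop where
  orthogonal : U ∈ Matrix.orthogonalGroup (Fin (n + 1)) ℝ
  diagonalizes : Uᵀ * symmetrized Q π * U =
    Matrix.diagonal (Fin.snoc (α := fun _ => ℝ) (fun j => - d j) 0)

/-- `T = Π^{-1/2} U`. -/
def matT {K : ℕ} (π : Fin K → ℝ) (U : Matrix (Fin K) (Fin K) ℝ) : Matrix (Fin K) (Fin K) ℝ :=
  Matrix.diagonal (fun i => (√(π i))⁻¹) * U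

/-- `b_j = T⁻¹(j,:) ∑ᵢ πᵢ tᵢⱼ P(:,i)` for `j < K = n + 1`. -/
def coefB {n : ℕ} (π : Fin (n + 1) → ℝ) (U P : Matrix (Fin (n + 1)) (Fin (n + 1)) ℝ)
    (j : Fin n) : ℝ :=
  (matT π U)⁻¹.row j.castSucc ⬝ᵥ ∑ i, (π i * matT π U i j.castSucc) • P.col i

/-- `a_j = b_j d_j`. -/
def coefA {n : ℕ} (π : Fin (n + 1) → ℝ) (U P : Matrix (Fin (n + 1)) (Fin (n + 1)) ℝ)
    (d : Fin n → ℝ) (j : Fin n) : ℝ :=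
  coefB π U P j * d j

/-- All the data of a time-reversible, irreducible chain on `K = n + 1` states, with its
diagonalization and a proximity matrix. -/
structure IsReversibleSetup {n : ℕ} (Q : Matrix (Fin (n + 1)) (Fin (n + 1)) ℝ)
    (π : Fin (n + 1) → ℝ) (U : Matrix (Fin (n + 1)) (Fin (n + 1)) ℝ) (d : Fin n → ℝ)
    (P : Matrix (Fin (n + 1)) (Fin (n + 1)) ℝ) : Prop where
  generator : IsGenerator Q
  irreducible : IsIrreducible Q
  stationary : IsStationary Q π
  reversible : IsTimeReversible Q π
  diagonalization : IsDiagonalization Q π U d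
  proximity : IsProximity P

end

end Freshness

open Freshness

/-! At a late time `t` the age `t - t'` of the latest sample is nearly exponential of rate `λ`,
independent of the chain, and the chain at time `t'` is nearly stationary. Hence `f(λ)` is the mean,
over an exponential age, of `stationaryMean`, the expectation of `p (X age) (X 0)` for the
stationary chain. The columns of `T` are eigenvectors of `Q`, so this function of the age is a
constant plus the sum of `b_j exp(-d_j t)` (`IsReversibleSetup.stationaryMean_eq`), and the
exponential law turns `exp(-d_j t)` into `λ / (λ + d_j)`. At age `0` the value is `1`, which gives
the second form of `f`.

Irreducibility makes `0` a simple eigenvalue, so every `d_j` is positive and the chain mixes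
exponentially fast. Both limits in the definition of mean freshness come from one estimate,
`abs_integral_fwc_mul_sub_le`: for matrices `p`, `q`, the expectation of `q`-freshness at `s` times
`p`-freshness at `t` is exponentially close to the expectation of the first factor times
`sampledMean`. To prove it, the path of `X` is averaged with the sampling times frozen; then the
Markov property, independence of Poisson increments, and the law of the age are used. With `q = 1`
the estimate gives convergence of means, and 0/1 matrices give convergence of laws. With centred
freshness it bounds correlations, and a second-moment law of large numbers gives the time average.
-/

namespace Freshness

/-! ### Exponentials of matrices -/

section Exponential

open scoped Matrix.Norms.Operator

variable {ι : Type*} [Fintype ι] [DecidableEq ι]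

lemma hasSum_exp_matrix (A : Matrix ι ι ℝ) :
    HasSum (fun k : ℕ => ((k.factorial : ℝ)⁻¹) • A ^ k) (NormedSpace.exp A) :=
  NormedSpace.exp_series_hasSum_exp' (𝕂 := ℝ) A

lemma hasSum_exp_matrix_apply (A : Matrix ι ι ℝ) (i j : ι) :
    HasSum (fun k : ℕ => ((k.factorial : ℝ)⁻¹) * (A ^ k) i j) (NormedSpace.exp A i j) := by
  have h := (hasSum_exp_matrix A).mapL
    (LinearMap.toContinuousLinearMap (Matrix.entryLinearMap ℝ ℝ i j))
  simpa using h

lemma pow_apply_nonneg {A : Matrix ι ι ℝ} (hA : ∀ i j, 0 ≤ A i j) (k : ℕ) (i j : ι) :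
    0 ≤ (A ^ k) i j := by
  induction k generalizing i j with
  | zero => rw [pow_zero, Matrix.one_apply]; split_ifs <;> norm_num
  | succ k ih =>
    rw [pow_succ, Matrix.mul_apply]
    exact Finset.sum_nonneg fun l _ => mul_nonneg (ih i l) (hA l j)

lemma exp_apply_ge {A : Matrix ι ι ℝ} (hA : ∀ i j, 0 ≤ A i j) (i j : ι) :
    A i j ≤ NormedSpace.exp A i j := by
  have h := le_hasSum (hasSum_exp_matrix_apply A i j) 1
    fun k _ => mul_nonneg (by positivity) (pow_apply_nonneg hA k i j)
  simpa using h

lemma exp_mulVec_of_mulVec_eq_smul {A : Matrix ι ι ℝ} {v : ι → ℝ} {c : ℝ}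
    (h : A *ᵥ v = c • v) : NormedSpace.exp A *ᵥ v = Real.exp c • v := by
  have hpow : ∀ k : ℕ, (A ^ k) *ᵥ v = c ^ k • v := by
    intro k
    induction k with
    | zero => simp
    | succ k ih => rw [pow_succ, ← Matrix.mulVec_mulVec, h, Matrix.mulVec_smul, ih, smul_smul,
        pow_succ']
  funext i
  have h1 : HasSum (fun k : ℕ => ((k.factorial : ℝ)⁻¹) * ((A ^ k) *ᵥ v) i)
      ((NormedSpace.exp A *ᵥ v) i) := by
    have := hasSum_sum (s := Finset.univ) fun j _ =>
      (hasSum_exp_matrix_apply A i j).mul_right (v j)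
    simpa only [Matrix.mulVec, dotProduct, Finset.mul_sum, mul_assoc] using this
  have h2 : HasSum (fun k : ℕ => ((k.factorial : ℝ)⁻¹) * ((A ^ k) *ᵥ v) i)
      ((Real.exp c • v) i) := by
    have := (NormedSpace.exp_series_hasSum_exp' (𝕂 := ℝ) c).mul_right (v i)
    rw [← Real.exp_eq_exp_ℝ] at this
    simpa only [hpow, Pi.smul_apply, smul_eq_mul, mul_assoc] using this
  exact h1.unique h2

lemma exp_add_smul_one (A : Matrix ι ι ℝ) (c : ℝ) :
    NormedSpace.exp (A + c • (1 : Matrix ι ι ℝ)) = Real.exp c • NormedSpace.exp A := by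
  rw [Matrix.exp_add_of_commute _ _ ((Commute.one_right A).smul_right c),
    Matrix.smul_one_eq_diagonal, Matrix.exp_diagonal]
  ext i j
  rw [Matrix.mul_diagonal, Pi.coe_exp, ← Real.exp_eq_exp_ℝ]
  simp [mul_comm]

end Exponential

/-! ### Transition probabilities -/

variable {K : ℕ} {Q : Matrix (Fin K) (Fin K) ℝ} {π : Fin K → ℝ}

/-- A multiple of the identity that makes all the entries of a generator nonnegative only rescales
its exponential. -/
lemma IsGenerator.exists_shift (hQ : IsGenerator Q) :
    ∃ c : ℝ, 0 ≤ c ∧ ∀ i j, 0 ≤ (Q + c • (1 : Matrix (Fin K) (Fin K) ℝ)) i j := by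
  refine ⟨∑ i, |Q i i|, Finset.sum_nonneg fun _ _ => abs_nonneg _, fun i j => ?_⟩
  rcases eq_or_ne i j with rfl | hij
  · have := Finset.single_le_sum (f := fun i => |Q i i|) (fun _ _ => abs_nonneg _)
      (Finset.mem_univ i)
    have h2 := neg_abs_le (Q i i)
    simp only [Matrix.add_apply, Matrix.smul_apply, Matrix.one_apply_eq, smul_eq_mul, mul_one]
    linarith
  · simpa [Matrix.one_apply_ne hij] using hQ.rate_nonneg i j hij

/-- Since `Q + c • 1` is entrywise nonnegative, `exp (t Q)` is `exp(-tc)` times a power series with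
nonnegative terms. Keeping only the linear term gives the lower bound, which serves to prove
irreducibility of a concrete chain. -/
lemma IsGenerator.transition_ge (hQ : IsGenerator Q) {t : ℝ} (ht : 0 ≤ t) :
    ∃ c : ℝ, 0 < c ∧ ∀ i j, 0 ≤ transition Q t i j ∧ (i ≠ j → c * (t * Q i j) ≤
      transition Q t i j) := by
  obtain ⟨c, hc, h⟩ := hQ.exists_shift
  have hA : ∀ i j, 0 ≤ (t • Q + (t * c) • (1 : Matrix (Fin K) (Fin K) ℝ)) i j := by
    intro i j
    have := mul_nonneg ht (h i j)
    simpa [mul_add, mul_assoc] using this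
  have he := exp_add_smul_one (t • Q) (t * c)
  have key : ∀ i j, transition Q t i j = Real.exp (-(t * c)) *
      NormedSpace.exp (t • Q + (t * c) • (1 : Matrix (Fin K) (Fin K) ℝ)) i j := by
    intro i j
    rw [he, Matrix.smul_apply, smul_eq_mul, ← mul_assoc, ← Real.exp_add]
    simp [transition]
  refine ⟨Real.exp (-(t * c)), Real.exp_pos _, fun i j => ⟨?_, fun hij => ?_⟩⟩
  · rw [key]
    exact mul_nonneg (Real.exp_pos _).le ((hA i j).trans (exp_apply_ge hA i j))
  · rw [key]
    refine mul_le_mul_of_nonneg_left ?_ (Real.exp_pos _).le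
    have := exp_apply_ge hA i j
    simpa [Matrix.one_apply_ne hij] using this

lemma IsGenerator.transition_nonneg (hQ : IsGenerator Q) {t : ℝ} (ht : 0 ≤ t) (i j : Fin K) :
    0 ≤ transition Q t i j := by
  obtain ⟨c, -, h⟩ := hQ.transition_ge ht
  exact (h i j).1

lemma transition_mulVec_of_mulVec_eq_smul {v : Fin K → ℝ} {c : ℝ} (h : Q *ᵥ v = c • v) (t : ℝ) :
    transition Q t *ᵥ v = Real.exp (t * c) • v :=
  exp_mulVec_of_mulVec_eq_smul (by rw [Matrix.smul_mulVec, h, smul_smul])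

lemma IsGenerator.transition_sum (hQ : IsGenerator Q) (t : ℝ) (i : Fin K) :
    ∑ j, transition Q t i j = 1 := by
  have h : Q *ᵥ (fun _ => 1) = (0 : ℝ) • (fun _ => 1) := by
    funext i; simp [Matrix.mulVec, dotProduct, hQ.row_sum]
  have := congrFun (transition_mulVec_of_mulVec_eq_smul h t) i
  simpa [Matrix.mulVec, dotProduct] using this

lemma IsStationary.vecMul_transition (hπ : IsStationary Q π) (t : ℝ) :
    π ᵥ* transition Q t = π := by
  have h : Qᵀ *ᵥ π = (0 : ℝ) • π := by rw [Matrix.mulVec_transpose, hπ.balance, zero_smul]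
  have := transition_mulVec_of_mulVec_eq_smul h t
  rw [transition, ← Matrix.transpose_smul, Matrix.exp_transpose, Matrix.mulVec_transpose] at this
  simpa [transition] using this

lemma IsStationary.pos (hπ : IsStationary Q π) (hQ : IsGenerator Q) (hirr : IsIrreducible Q)
    (j : Fin K) : 0 < π j := by
  obtain ⟨i, hi⟩ : ∃ i, 0 < π i := by
    by_contra! h
    have := Finset.sum_nonpos fun i (_ : i ∈ Finset.univ) => h i
    rw [hπ.sum_eq_one] at this
    linarith
  obtain ⟨t, ht, hpos⟩ := hirr i j
  have h1 := congrFun (hπ.vecMul_transition t) j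
  rw [← h1, Matrix.vecMul, dotProduct]
  exact (mul_pos hi hpos).trans_le (Finset.single_le_sum (f := fun k => π k * transition Q t k j)
    (fun k _ => mul_nonneg (hπ.nonneg k) (hQ.transition_nonneg ht k j)) (Finset.mem_univ i))

/-- A harmonic function of an irreducible chain is constant. -/
lemma IsGenerator.eq_of_mulVec_eq_zero (hQ : IsGenerator Q) (hirr : IsIrreducible Q)
    {v : Fin K → ℝ} (hv : Q *ᵥ v = 0) (i j : Fin K) : v i = v j := by
  have : Nonempty (Fin K) := ⟨i⟩
  obtain ⟨m, hm⟩ := Finite.exists_max v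
  suffices h : ∀ j, v j = v m by rw [h i, h j]
  intro j
  obtain ⟨t, ht, hpos⟩ := hirr m j
  have h0 : Q *ᵥ v = (0 : ℝ) • v := by rw [hv, zero_smul]
  have h1 := congrFun (transition_mulVec_of_mulVec_eq_smul h0 t) m
  -- Maximum principle: `v m` is an average of the values `v k ≤ v m`, so every state that `m`
  -- reaches with positive probability carries the same value.
  have h2 : ∑ k, transition Q t m k * (v m - v k) = 0 := by
    simp only [mul_sub, Finset.sum_sub_distrib, ← Finset.sum_mul, hQ.transition_sum, one_mul]
    rw [sub_eq_zero]
    simpa [Matrix.mulVec, dotProduct] using h1.symm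
  have h3 := (Finset.sum_eq_zero_iff_of_nonneg fun k _ =>
    mul_nonneg (hQ.transition_nonneg ht m k) (sub_nonneg.2 (hm k))).1 h2 j (Finset.mem_univ j)
  rcases mul_eq_zero.1 h3 with h | h
  · exact absurd h hpos.ne'
  · linarith

/-- The real eigenvalues of a generator are nonpositive. -/
lemma IsGenerator.eigenvalue_nonpos (hQ : IsGenerator Q) {v : Fin K → ℝ} (hv : v ≠ 0) {c : ℝ}
    (h : Q *ᵥ v = c • v) : c ≤ 0 := by
  obtain ⟨i, hi⟩ := Function.ne_iff.1 hv
  have : Nonempty (Fin K) := ⟨i⟩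
  obtain ⟨m, hm⟩ := Finite.exists_max fun k => |v k|
  have hmpos : 0 < |v m| := (abs_pos.2 hi).trans_le (hm i)
  have h1 := congrFun (transition_mulVec_of_mulVec_eq_smul h 1) m
  simp only [Matrix.mulVec, dotProduct, one_mul, Pi.smul_apply, smul_eq_mul] at h1
  -- A stochastic matrix does not increase the sup norm, while it multiplies the eigenvector by `exp
  -- c`.
  have h2 : Real.exp c * |v m| ≤ 1 * |v m| := by
    rw [← abs_of_pos (Real.exp_pos c), ← abs_mul, ← h1]
    nth_rewrite 2 [← hQ.transition_sum 1 m]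
    rw [Finset.sum_mul]
    refine (Finset.abs_sum_le_sum_abs _ _).trans (Finset.sum_le_sum fun k _ => ?_)
    rw [abs_mul, abs_of_nonneg (hQ.transition_nonneg zero_le_one m k)]
    exact mul_le_mul_of_nonneg_left (hm k) (hQ.transition_nonneg zero_le_one m k)
  have h3 := le_of_mul_le_mul_right h2 hmpos
  by_contra! hc
  exact absurd (Real.one_lt_exp_iff.2 hc) (not_lt.2 h3)

lemma continuous_transition_apply (Q : Matrix (Fin K) (Fin K) ℝ) (i j : Fin K) :
    Continuous fun t => transition Q t i j := by
  open scoped Matrix.Norms.Operator in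
  have h : Continuous fun t : ℝ => transition Q t :=
    (NormedSpace.exp_continuous (𝔸 := Matrix (Fin K) (Fin K) ℝ)).comp (by fun_prop)
  exact h.matrix_elem i j

lemma transition_zero (Q : Matrix (Fin K) (Fin K) ℝ) : transition Q 0 = 1 := by
  simp [transition]

/-! ### Spectral form of the transition probabilities -/

section Spectral

variable {n : ℕ} {Q : Matrix (Fin (n + 1)) (Fin (n + 1)) ℝ} {π : Fin (n + 1) → ℝ}
  {U : Matrix (Fin (n + 1)) (Fin (n + 1)) ℝ} {d : Fin n → ℝ}

lemma matT_inv (hπ : ∀ i, 0 < π i) (hU : U ∈ Matrix.orthogonalGroup (Fin (n + 1)) ℝ) :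
    (matT π U)⁻¹ = Uᵀ * Matrix.diagonal (fun i => √(π i)) := by
  refine Matrix.inv_eq_left_inv ?_
  have h1 : Matrix.diagonal (fun i => √(π i)) * Matrix.diagonal (fun i => (√(π i))⁻¹) = 1 := by
    rw [Matrix.diagonal_mul_diagonal, ← Matrix.diagonal_one]
    congr 1
    funext i
    exact mul_inv_cancel₀ (Real.sqrt_ne_zero'.2 (hπ i))
  have h2 : Uᵀ * U = 1 := (Matrix.mem_orthogonalGroup_iff' _ _).1 hU
  rw [matT, Matrix.mul_assoc, ← Matrix.mul_assoc (Matrix.diagonal _), h1, Matrix.one_mul, h2]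

lemma matT_mul_inv (hπ : ∀ i, 0 < π i) (hU : U ∈ Matrix.orthogonalGroup (Fin (n + 1)) ℝ) :
    matT π U * (matT π U)⁻¹ = 1 := by
  have h2 : U * Uᵀ = 1 := (Matrix.mem_orthogonalGroup_iff _ _).1 hU
  rw [matT_inv hπ hU, matT, Matrix.mul_assoc, ← Matrix.mul_assoc U, h2, Matrix.one_mul,
    Matrix.diagonal_mul_diagonal, ← Matrix.diagonal_one]
  congr 1
  funext i
  exact inv_mul_cancel₀ (Real.sqrt_ne_zero'.2 (hπ i))

lemma IsDiagonalization.mul_matT (h : IsDiagonalization Q π U d) (hπ : ∀ i, 0 < π i) :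
    Q * matT π U =
      matT π U * Matrix.diagonal (Fin.snoc (α := fun _ => ℝ) (fun j => - d j) 0) := by
  have h2 : U * Uᵀ = 1 := (Matrix.mem_orthogonalGroup_iff _ _).1 h.orthogonal
  have h1 : Matrix.diagonal (fun i => (√(π i))⁻¹) * Matrix.diagonal (fun i => √(π i)) = 1 := by
    rw [Matrix.diagonal_mul_diagonal, ← Matrix.diagonal_one]
    congr 1
    funext i
    exact inv_mul_cancel₀ (Real.sqrt_ne_zero'.2 (hπ i))
  rw [← h.diagonalizes, matT, symmetrized]
  simp only [Matrix.mul_assoc]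
  rw [← Matrix.mul_assoc U, h2, Matrix.one_mul,
    ← Matrix.mul_assoc (Matrix.diagonal fun i => (√(π i))⁻¹) (Matrix.diagonal fun i => √(π i)),
    h1, Matrix.one_mul]

lemma IsDiagonalization.mulVec_matT_col (h : IsDiagonalization Q π U d) (hπ : ∀ i, 0 < π i)
    (k : Fin (n + 1)) :
    Q *ᵥ (fun i => matT π U i k) =
      (Fin.snoc (α := fun _ => ℝ) (fun j => - d j) 0 : Fin (n + 1) → ℝ) k •
        (fun i => matT π U i k) := by
  funext i
  have := congrFun (congrFun (h.mul_matT hπ) i) k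
  rw [Matrix.mul_diagonal, Matrix.mul_apply] at this
  simpa [Matrix.mulVec, dotProduct, mul_comm] using this

lemma matT_apply (π : Fin (n + 1) → ℝ) (U : Matrix (Fin (n + 1)) (Fin (n + 1)) ℝ)
    (i k : Fin (n + 1)) : matT π U i k = (√(π i))⁻¹ * U i k := by
  rw [matT, Matrix.diagonal_mul]

lemma orthogonal_col (hU : U ∈ Matrix.orthogonalGroup (Fin (n + 1)) ℝ) (k l : Fin (n + 1)) :
    ∑ i, U i k * U i l = if k = l then 1 else 0 := by
  have := congrFun (congrFun ((Matrix.mem_orthogonalGroup_iff' _ _).1 hU) k) l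
  simpa [Matrix.mul_apply, Matrix.one_apply] using this

lemma matT_col_ne_zero (hπ : ∀ i, 0 < π i) (hU : U ∈ Matrix.orthogonalGroup (Fin (n + 1)) ℝ)
    (k : Fin (n + 1)) : (fun i => matT π U i k) ≠ 0 := by
  intro h
  have h0 : ∀ i, U i k = 0 := fun i => by
    have := congrFun h i
    rw [matT_apply] at this
    exact (mul_eq_zero.1 this).resolve_left (inv_ne_zero (Real.sqrt_ne_zero'.2 (hπ i)))
  simpa [h0] using orthogonal_col hU k k

/-- A constant column of `T` corresponds to a multiple of `√π` in `U`. -/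
lemma eq_mul_sqrt_of_matT_const (hπ : ∀ i, 0 < π i) {k : Fin (n + 1)}
    (h : ∀ i j, matT π U i k = matT π U j k) (i : Fin (n + 1)) :
    U i k = matT π U 0 k * √(π i) := by
  rw [h 0 i, matT_apply, mul_right_comm, inv_mul_cancel₀ (Real.sqrt_ne_zero'.2 (hπ i)), one_mul]

/-- The last column of `T` has eigenvalue `0`, hence is harmonic. Consequently the last column of
`U` is `√π` up to a sign, which `matT_last_sq` records. -/
lemma IsDiagonalization.matT_last (h : IsDiagonalization Q π U d) (hQ : IsGenerator Q)
    (hirr : IsIrreducible Q) (hst : IsStationary Q π) (i j : Fin (n + 1)) :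
    matT π U i (Fin.last n) = matT π U j (Fin.last n) := by
  refine hQ.eq_of_mulVec_eq_zero (v := fun i => matT π U i (Fin.last n)) hirr ?_ i j
  simpa using h.mulVec_matT_col (hst.pos hQ hirr) (Fin.last n)

lemma IsDiagonalization.matT_last_sq (h : IsDiagonalization Q π U d) (hQ : IsGenerator Q)
    (hirr : IsIrreducible Q) (hst : IsStationary Q π) :
    matT π U 0 (Fin.last n) * matT π U 0 (Fin.last n) = 1 := by
  have h1 := orthogonal_col h.orthogonal (Fin.last n) (Fin.last n)
  simp only [eq_mul_sqrt_of_matT_const (hst.pos hQ hirr) (h.matT_last hQ hirr hst),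
    mul_mul_mul_comm _ (√_), Real.mul_self_sqrt (hst.nonneg _), ← Finset.mul_sum,
    hst.sum_eq_one, mul_one, if_true] at h1
  exact h1

/-- If `d j = 0`, column `j` of `T` would be harmonic too, so columns `j` and last of `U` would both
be multiples of `√π`, against orthonormality. -/
lemma IsDiagonalization.pos (h : IsDiagonalization Q π U d) (hQ : IsGenerator Q)
    (hirr : IsIrreducible Q) (hst : IsStationary Q π) (j : Fin n) : 0 < d j := by
  have hπ := hst.pos hQ hirr
  have heig := h.mulVec_matT_col hπ j.castSucc
  have hne := matT_col_ne_zero hπ h.orthogonal j.castSucc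
  have hle := hQ.eigenvalue_nonpos hne heig
  rw [Fin.snoc_castSucc] at hle heig
  refine lt_of_le_of_ne (by linarith) fun h0 => hne ?_
  rw [← h0, neg_zero, zero_smul] at heig
  have hc := hQ.eq_of_mulVec_eq_zero hirr heig
  have h1 := orthogonal_col h.orthogonal j.castSucc (Fin.last n)
  simp only [eq_mul_sqrt_of_matT_const hπ (h.matT_last hQ hirr hst),
    eq_mul_sqrt_of_matT_const hπ hc,
    mul_mul_mul_comm _ (√_), Real.mul_self_sqrt (hst.nonneg _), ← Finset.mul_sum,
    hst.sum_eq_one, mul_one, if_neg (Fin.castSucc_lt_last j).ne] at h1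
  have h2 := h.matT_last_sq hQ hirr hst
  have h3 : matT π U 0 j.castSucc = 0 := by
    rcases mul_eq_zero.1 h1 with h | h
    · exact h
    · rw [h] at h2; norm_num at h2
  funext i
  exact (hc i 0).trans h3

/-- The transition probabilities in terms of the eigenvalues of the generator. -/
lemma IsDiagonalization.transition_apply (h : IsDiagonalization Q π U d) (hQ : IsGenerator Q)
    (hirr : IsIrreducible Q) (hst : IsStationary Q π) (t : ℝ) (i j : Fin (n + 1)) :
    transition Q t i j = π j + ∑ k : Fin n,
      matT π U i k.castSucc * (matT π U)⁻¹ k.castSucc j * Real.exp (-(d k * t)) := by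
  have hπ := hst.pos hQ hirr
  have h1 : transition Q t * matT π U = matT π U * Matrix.diagonal (fun k => Real.exp
      (t * (Fin.snoc (α := fun _ => ℝ) (fun j => - d j) 0 : Fin (n + 1) → ℝ) k)) := by
    ext i k
    have := congrFun (transition_mulVec_of_mulVec_eq_smul (h.mulVec_matT_col hπ k) t) i
    rw [Matrix.mul_diagonal, Matrix.mul_apply, mul_comm]
    simpa [Matrix.mulVec, dotProduct] using this
  have h2 : transition Q t = matT π U * Matrix.diagonal (fun k => Real.exp
      (t * (Fin.snoc (α := fun _ => ℝ) (fun j => - d j) 0 : Fin (n + 1) → ℝ) k)) *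
      (matT π U)⁻¹ := by
    rw [← h1, Matrix.mul_assoc, matT_mul_inv hπ h.orthogonal, Matrix.mul_one]
  rw [h2, Matrix.mul_apply, Fin.sum_univ_castSucc, add_comm]
  congr 1
  -- The eigenvalue `0` contributes `π j`; the undetermined sign of the last column enters squared.
  · simp only [Matrix.mul_diagonal, Fin.snoc_last, mul_zero, Real.exp_zero, mul_one]
    rw [matT_inv hπ h.orthogonal, Matrix.mul_diagonal, Matrix.transpose_apply,
      h.matT_last hQ hirr hst i 0, eq_mul_sqrt_of_matT_const hπ (h.matT_last hQ hirr hst),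
      mul_assoc, Real.mul_self_sqrt (hst.nonneg _), ← mul_assoc, h.matT_last_sq hQ hirr hst,
      one_mul]
  · refine Finset.sum_congr rfl fun k _ => ?_
    simp only [Matrix.mul_diagonal, Fin.snoc_castSucc]
    rw [mul_right_comm, mul_neg, mul_comm t]

/-- The transition probabilities converge to the stationary distribution exponentially fast. -/
lemma IsDiagonalization.exists_abs_transition_sub_le (h : IsDiagonalization Q π U d)
    (hQ : IsGenerator Q) (hirr : IsIrreducible Q) (hst : IsStationary Q π) :
    ∃ C c : ℝ, 0 < C ∧ 0 < c ∧ ∀ t, 0 ≤ t → ∀ i j,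
      |transition Q t i j - π j| ≤ C * Real.exp (-(c * t)) := by
  -- The rate is the spectral gap; with a single state there is none and any positive number serves.
  obtain ⟨c, hc, hcd⟩ : ∃ c : ℝ, 0 < c ∧ ∀ k, c ≤ d k := by
    rcases isEmpty_or_nonempty (Fin n) with hn | hn
    · exact ⟨1, one_pos, fun k => (hn.false k).elim⟩
    · obtain ⟨m, hm⟩ := Finite.exists_min d
      exact ⟨d m, h.pos hQ hirr hst m, hm⟩
  set B : Fin (n + 1) → Fin (n + 1) → ℝ := fun i j =>
    ∑ k : Fin n, |matT π U i k.castSucc * (matT π U)⁻¹ k.castSucc j|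
  have hB : ∀ i j, 0 ≤ B i j := fun i j => Finset.sum_nonneg fun _ _ => abs_nonneg _
  refine ⟨1 + ∑ i, ∑ j, B i j, c, by
    have := Finset.sum_nonneg fun i (_ : i ∈ Finset.univ) =>
      Finset.sum_nonneg fun j (_ : j ∈ Finset.univ) => hB i j
    linarith, hc, fun t ht i j => ?_⟩
  rw [h.transition_apply hQ hirr hst, add_sub_cancel_left]
  calc _ ≤ ∑ k : Fin n, |matT π U i k.castSucc * (matT π U)⁻¹ k.castSucc j| *
        Real.exp (-(c * t)) := by
        refine (Finset.abs_sum_le_sum_abs _ _).trans (Finset.sum_le_sum fun k _ => ?_)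
        rw [abs_mul, Real.abs_exp]
        have := mul_le_mul_of_nonneg_right (hcd k) ht
        gcongr
    _ = B i j * Real.exp (-(c * t)) := by rw [Finset.sum_mul]
    _ ≤ _ := by
        refine mul_le_mul_of_nonneg_right ?_ (Real.exp_pos _).le
        have h1 := Finset.single_le_sum (f := fun j => B i j) (fun j _ => hB i j)
          (Finset.mem_univ j)
        have h2 := Finset.single_le_sum (f := fun i => ∑ j, B i j)
          (fun i _ => Finset.sum_nonneg fun j _ => hB i j) (Finset.mem_univ i)
        linarith

end Spectral

/-! ### Right-continuous processes -/

/-- A right-continuous process is jointly measurable. -/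
lemma measurable_uncurry_of_right_continuous {Ω β : Type*} [MeasurableSpace Ω]
    [TopologicalSpace β] [TopologicalSpace.PseudoMetrizableSpace β] [MeasurableSpace β]
    [BorelSpace β] {Y : ℝ≥0 → Ω → β} (hm : ∀ t, Measurable (Y t))
    (hc : ∀ ω t, ContinuousWithinAt (fun s => Y s ω) (Set.Ici t) t) :
    Measurable fun p : Ω × ℝ≥0 => Y p.2 p.1 := by
  -- The `m + 1` places the grid point attached to `t` to the right of `t`, where continuity is
  -- available.
  obtain ⟨D, hD⟩ : ∃ D : ℕ → ℕ → ℝ≥0, ∀ k m, D k m = (m + 1) / (k + 1) := ⟨_, fun _ _ => rfl⟩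
  refine measurable_of_tendsto_metrizable
    (f := fun (k : ℕ) (p : Ω × ℝ≥0) => Y (D k ⌊(k + 1 : ℝ≥0) * p.2⌋₊) p.1) ?_ ?_
  · exact fun k => (measurable_from_prod_countable_left (f := fun p : Ω × ℕ => Y (D k p.2) p.1)
      fun m => hm (D k m)).comp (measurable_fst.prodMk
        (Nat.measurable_floor.comp (measurable_snd.const_mul (k + 1 : ℝ≥0))))
  · rw [tendsto_pi_nhds]
    rintro ⟨ω, t⟩
    refine (hc ω t).tendsto.comp (tendsto_nhdsWithin_iff.2 ⟨?_, Eventually.of_forall fun k => ?_⟩)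
    · have h0 : Tendsto (fun k : ℕ => t + 1 / ((k : ℝ≥0) + 1)) atTop (𝓝 t) := by
        simpa using tendsto_const_nhds.add (tendsto_one_div_add_atTop_nhds_zero_nat (𝕜 := ℝ≥0))
      refine tendsto_of_tendsto_of_tendsto_of_le_of_le tendsto_const_nhds h0 (fun k => ?_)
        fun k => ?_
      · dsimp only
        rw [hD, le_div_iff₀ (by positivity), mul_comm]
        exact (Nat.lt_floor_add_one _).le
      · dsimp only
        rw [hD, div_le_iff₀ (by positivity), add_mul t, one_div, inv_mul_cancel₀ (by positivity),
          mul_comm t]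
        gcongr
        exact Nat.floor_le zero_le
    · rw [Set.mem_Ici, hD, le_div_iff₀ (by positivity), mul_comm]
      exact (Nat.lt_floor_add_one _).le

/-- Right-continuous paths in `Fin K`. -/
abbrev RightContPath (K : ℕ) : Type :=
  {x : ℝ≥0 → Fin K // ∀ t, ContinuousWithinAt x (Set.Ici t) t}

/-- Evaluation at a variable time need not be measurable on the space of all paths. On this subtype
it is, so `X` at a random time is a measurable function of the path and the time. -/
lemma measurable_rightContPath_eval (K : ℕ) :
    Measurable fun p : RightContPath K × ℝ≥0 => p.1.1 p.2 :=
  measurable_uncurry_of_right_continuous (Y := fun t (x : RightContPath K) => x.1 t)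
    (fun t => (measurable_pi_apply t).comp measurable_subtype_coe) fun x t => x.2 t

/-- Fubini's theorem for independent random variables. -/
lemma integral_indepFun_prod {Ω α β : Type*} [MeasurableSpace Ω] [MeasurableSpace α]
    [MeasurableSpace β] {μ : Measure Ω} [IsProbabilityMeasure μ] {V : Ω → α} {Z : Ω → β}
    (hV : Measurable V) (hZ : Measurable Z) (h : IndepFun V Z μ) {Φ : α × β → ℝ}
    (hΦ : Measurable Φ) {B : ℝ} (hB : ∀ p, |Φ p| ≤ B) :
    ∫ ω, Φ (V ω, Z ω) ∂μ = ∫ ω, ∫ ω', Φ (V ω', Z ω) ∂μ ∂μ := by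
  have := Measure.isProbabilityMeasure_map (μ := μ) hV.aemeasurable
  have := Measure.isProbabilityMeasure_map (μ := μ) hZ.aemeasurable
  have hint : Integrable Φ ((μ.map V).prod (μ.map Z)) :=
    Integrable.of_bound hΦ.aestronglyMeasurable B (ae_of_all _ hB)
  rw [← integral_map (φ := fun ω => (V ω, Z ω)) (hV.prodMk hZ).aemeasurable
      hΦ.aestronglyMeasurable,
    (indepFun_iff_map_prod_eq_prod_map_map hV.aemeasurable hZ.aemeasurable).1 h,
    integral_prod_symm _ hint,
    integral_map hZ.aemeasurable hint.integral_prod_right.aestronglyMeasurable]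
  refine integral_congr_ae (ae_of_all _ fun ω => ?_)
  exact integral_map hV.aemeasurable (hΦ.comp measurable_prodMk_right).aestronglyMeasurable

/-! ### The latest sampling time -/

section LastSample

variable {Ω : Type*} {N : ℝ≥0 → Ω → ℕ}

lemma lastSample_le (N : ℝ≥0 → Ω → ℕ) (t : ℝ≥0) (ω : Ω) : lastSample N t ω ≤ t :=
  csSup_le ⟨0, Set.mem_insert _ _, zero_le⟩ fun _ h => h.2

/-- If `N` increases between `r` and `t`, the first time it reaches the level `N t ω` is attained by
right continuity, and is a sampling time in `(r, t]`. This turns events about the latest sample into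
events about increments. -/
lemma lastSample_le_iff {ω : Ω} (hmono : Monotone fun t => N t ω)
    (hc : ∀ t, ContinuousWithinAt (fun s => N s ω) (Set.Ici t) t) {r t : ℝ≥0} (hrt : r ≤ t) :
    lastSample N t ω ≤ r ↔ N t ω = N r ω := by
  constructor
  · intro h
    by_contra hne
    have hlt : N r ω < N t ω := lt_of_le_of_ne (hmono hrt) (Ne.symm hne)
    set A : Set ℝ≥0 := {x | N t ω ≤ N x ω} with hA
    have htA : t ∈ A := le_refl (N t ω)
    have hglb : IsGLB A (sInf A) := isGLB_csInf ⟨t, htA⟩ (OrderBot.bddBelow A)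
    have hev : ∀ᶠ x in 𝓝[≥] (sInf A), N x ω = N (sInf A) ω :=
      (hc (sInf A)).tendsto.eventually (p := fun m => m = _) (by simp)
    obtain ⟨x, hxA, hx⟩ := ((hglb.frequently_mem ⟨t, htA⟩).and_eventually hev).exists
    have hsA : N t ω ≤ N (sInf A) ω := hx ▸ hxA
    have hrs : r < sInf A := by
      by_contra! hle
      exact absurd (hsA.trans (hmono hle)) (not_le.2 hlt)
    have hmem : sInf A ∈ {s | s ∈ samplingTimes N ω ∧ s ≤ t} := by
      refine ⟨Or.inr ⟨zero_le.trans_lt hrs, fun y hy => ?_⟩, hglb.1 htA⟩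
      by_contra! hle
      exact absurd (hglb.1 (show y ∈ A from hsA.trans hle)) (not_le.2 hy)
    exact absurd ((le_csSup ⟨t, fun _ h => h.2⟩ hmem).trans h) (not_le.2 hrs)
  · intro h
    refine csSup_le ⟨0, Set.mem_insert _ _, zero_le⟩ fun s hs => ?_
    by_contra! hrs
    rcases hs.1 with rfl | h0
    · exact absurd zero_le (not_le.2 hrs)
    · have h1 := h0.2 r hrs
      have h2 : N s ω ≤ N t ω := hmono hs.2
      omega

lemma lastSample_eventuallyEq {ω : Ω} (hmono : Monotone fun t => N t ω)
    (hc : ∀ t, ContinuousWithinAt (fun s => N s ω) (Set.Ici t) t) (t : ℝ≥0) :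
    ∀ᶠ x in 𝓝[≥] t, lastSample N x ω = lastSample N t ω := by
  have hev : ∀ᶠ x in 𝓝[≥] t, N x ω = N t ω := (hc t).tendsto.eventually (p := fun m => m = _) (by simp)
  filter_upwards [hev, self_mem_nhdsWithin] with x hx hxt
  have hle := (lastSample_le_iff hmono hc hxt).2 hx
  have hset : {s | s ∈ samplingTimes N ω ∧ s ≤ x} = {s | s ∈ samplingTimes N ω ∧ s ≤ t} := by
    ext s
    exact ⟨fun h => ⟨h.1, (le_csSup ⟨x, fun _ h => h.2⟩ h).trans hle⟩,
      fun h => ⟨h.1, h.2.trans hxt⟩⟩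
  rw [lastSample, lastSample, hset]

variable [MeasurableSpace Ω] {μ : Measure Ω} {r : ℝ}

lemma IsPoissonProcess.lastSample_le_iff (hN : IsPoissonProcess μ r N) {b t : ℝ≥0} (hbt : b ≤ t)
    (ω : Ω) : lastSample N t ω ≤ b ↔ N t ω = N b ω :=
  Freshness.lastSample_le_iff (hN.monotone ω) (hN.right_continuous ω) hbt

/-- Measurability with respect to the σ-algebra of `N` alone is what transfers independence from
`X`. -/
lemma IsPoissonProcess.measurable_lastSample_comap (hN : IsPoissonProcess μ r N) (t : ℝ≥0) :
    Measurable[MeasurableSpace.comap (fun ω t => N t ω) inferInstance] (lastSample N t) := by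
  refine @measurable_of_Iic _ _ _ _ _ _ _ _ _ _ fun b => ?_
  rcases le_total t b with h | h
  · have : lastSample N t ⁻¹' Set.Iic b = Set.univ :=
      Set.eq_univ_of_forall fun ω => (lastSample_le N t ω).trans h
    rw [this]
    exact MeasurableSet.univ
  · refine ⟨{x | x t = x b}, measurableSet_eq_fun (measurable_pi_apply t) (measurable_pi_apply b),
      ?_⟩
    ext ω
    exact (hN.lastSample_le_iff h ω).symm

lemma IsPoissonProcess.measurable_lastSample (hN : IsPoissonProcess μ r N) (t : ℝ≥0) :
    Measurable (lastSample N t) :=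
  (hN.measurable_lastSample_comap t).mono
    (measurable_pi_iff.2 fun s => hN.measurable s).comap_le le_rfl

lemma IsPoissonProcess.measureReal_lastSample_le (hN : IsPoissonProcess μ r N) (hr : 0 < r)
    {b t : ℝ≥0} (hbt : b ≤ t) :
    μ.real {ω | lastSample N t ω ≤ b} = Real.exp (-(r * ((t : ℝ) - b))) := by
  have hbt' : (b : ℝ) ≤ t := NNReal.coe_le_coe.2 hbt
  have h1 : {ω | lastSample N t ω ≤ b} = (fun ω => N t ω - N b ω) ⁻¹' {0} := by
    ext ω
    have := hN.monotone ω hbt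
    simp only [Set.mem_ofPred_eq, hN.lastSample_le_iff hbt, Set.mem_preimage,
      Set.mem_singleton_iff]
    dsimp only at this
    omega
  rw [h1, ← map_measureReal_apply (f := fun ω => N t ω - N b ω)
    ((hN.measurable t).sub (hN.measurable b)) (measurableSet_singleton 0), (hN.law_increment b t hbt).map_eq,
    poissonMeasure_real_singleton, Real.coe_toNNReal _ (by nlinarith)]
  simp

/-- Sampling times in disjoint time intervals are independent. -/
lemma IsPoissonProcess.indepFun_lastSample (hN : IsPoissonProcess μ r N)
    [IsProbabilityMeasure μ] {s u t : ℝ≥0} (hsu : s ≤ u) :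
    IndepFun (lastSample N s) (fun ω => max (lastSample N t ω) u) μ := by
  rw [IndepFun_iff_Indep]
  refine IndepSets.indep (hN.measurable_lastSample s).comap_le
    ((hN.measurable_lastSample t).max measurable_const).comap_le
    ((isPiSystem_Iic).comap (lastSample N s))
    ((isPiSystem_Iic).comap fun ω => max (lastSample N t ω) u)
    ?_ ?_ ?_
  · rw [BorelSpace.measurable_eq (α := ℝ≥0), borel_eq_generateFrom_Iic,
      MeasurableSpace.comap_generateFrom]
    rfl
  · rw [BorelSpace.measurable_eq (α := ℝ≥0), borel_eq_generateFrom_Iic,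
      MeasurableSpace.comap_generateFrom]
    rfl
  rw [IndepSets_iff]
  rintro _ _ ⟨_, ⟨a, rfl⟩, rfl⟩ ⟨_, ⟨b, rfl⟩, rfl⟩
  rcases le_total s a with hsa | has
  · have : lastSample N s ⁻¹' Set.Iic a = Set.univ :=
      Set.eq_univ_of_forall fun ω => (lastSample_le N s ω).trans hsa
    rw [this]; simp
  rcases lt_or_ge b u with hbu | hub
  · have : (fun ω => max (lastSample N t ω) u) ⁻¹' Set.Iic b = ∅ :=
      Set.eq_empty_of_forall_notMem fun ω h => absurd ((le_max_right _ _).trans h) (not_le.2 hbu)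
    rw [this]; simp
  rcases le_total t b with htb | hbt
  · have : (fun ω => max (lastSample N t ω) u) ⁻¹' Set.Iic b = Set.univ :=
      Set.eq_univ_of_forall fun ω => max_le ((lastSample_le N t ω).trans htb) hub
    rw [this]; simp
  -- In the remaining case both events say that `N` is constant on an interval, `[a, s]` and `[b,
  -- t]` with `s ≤ b`. These are increments `0` and `2` along `τ`.
  let τ : ℕ → ℝ≥0
    | 0 => a
    | 1 => s
    | 2 => b
    | _ => t
  have hτ : Monotone τ := by
    refine monotone_nat_of_le_succ fun k => ?_
    match k with
    | 0 => exact has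
    | 1 => exact hsu.trans hub
    | 2 => exact hbt
    | k + 3 => exact le_rfl
  have hind := (hN.indep_increments.nat hτ).indepFun (show (0 : ℕ) ≠ 2 by norm_num)
  have h1 : lastSample N s ⁻¹' Set.Iic a = (fun ω => N s ω - N a ω) ⁻¹' {0} := by
    ext ω
    have := hN.monotone ω has
    simp only [Set.mem_preimage, Set.mem_Iic, hN.lastSample_le_iff has, Set.mem_singleton_iff]
    dsimp only at this
    omega
  have h2 : (fun ω => max (lastSample N t ω) u) ⁻¹' Set.Iic b =
      (fun ω => N t ω - N b ω) ⁻¹' {0} := by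
    ext ω
    have := hN.monotone ω hbt
    simp only [Set.mem_preimage, Set.mem_Iic, max_le_iff, hub, and_true,
      hN.lastSample_le_iff hbt, Set.mem_singleton_iff]
    dsimp only at this
    omega
  rw [h1, h2]
  exact hind.measure_inter_preimage_eq_mul _ _ (measurableSet_singleton 0)
    (measurableSet_singleton 0)

end LastSample

/-! ### The age of the latest sample -/

lemma expMeasure_absolutelyContinuous (r : ℝ) : expMeasure r ≪ volume :=
  withDensity_absolutelyContinuous _ _

lemma measureReal_expMeasure_Ici {r : ℝ} (hr : 0 < r) (x : ℝ) :
    (expMeasure r).real (Set.Ici x) = if 0 ≤ x then Real.exp (-(r * x)) else 1 := by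
  have := isProbabilityMeasure_expMeasure hr
  have h0 : (expMeasure r).real {x} = 0 := by
    rw [measureReal_def, expMeasure_absolutelyContinuous r (by simp), ENNReal.toReal_zero]
  have h1 : (expMeasure r).real (Set.Ici x) = (expMeasure r).real (Set.Ioi x) := by
    rw [← Set.Ioi_insert, Set.insert_eq, measureReal_union (by simp) measurableSet_Ioi, h0,
      zero_add]
  rw [h1, ← Set.compl_Iic, probReal_compl_eq_one_sub measurableSet_Iic, ← cdf_eq_real,
    cdf_expMeasure_eq hr]
  split_ifs <;> ring

lemma expMeasure_ae_nonneg {r : ℝ} (hr : 0 < r) : ∀ᵐ x ∂expMeasure r, 0 ≤ x := by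
  have := isProbabilityMeasure_expMeasure hr
  have h : (expMeasure r).real (Set.Ici 0) = 1 := by
    simp [measureReal_expMeasure_Ici hr]
  have h2 : expMeasure r (Set.Ici 0) = 1 := by
    rw [← ENNReal.toReal_eq_one_iff]; exact h
  exact (prob_compl_eq_zero_iff measurableSet_Ici).2 h2

/-- The age of the latest sample, truncated at `t - u`, is a truncated exponential variable. -/
lemma IsPoissonProcess.map_age {Ω : Type*} [MeasurableSpace Ω] {μ : Measure Ω}
    [IsProbabilityMeasure μ] {r : ℝ} {N : ℝ≥0 → Ω → ℕ} (hN : IsPoissonProcess μ r N) (hr : 0 < r)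
    {u t : ℝ≥0} (hut : u ≤ t) :
    μ.map (fun ω => (t : ℝ) - (max (lastSample N t ω) u : ℝ≥0)) =
      (expMeasure r).map fun x => min x ((t : ℝ) - u) := by
  have hut' : (u : ℝ) ≤ t := NNReal.coe_le_coe.2 hut
  have := isProbabilityMeasure_expMeasure hr
  have hm1 : Measurable fun ω => (t : ℝ) - (max (lastSample N t ω) u : ℝ≥0) :=
    measurable_const.sub ((hN.measurable_lastSample t).max measurable_const).coe_nnreal_real
  have hm2 : Measurable fun x : ℝ => min x ((t : ℝ) - u) := by fun_prop
  have := Measure.isProbabilityMeasure_map (μ := μ) hm1.aemeasurable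
  have := Measure.isProbabilityMeasure_map (μ := expMeasure r) hm2.aemeasurable
  -- For `0 ≤ x ≤ t - u`, an age of at least `x` means no sample after `t - x`, an event of
  -- probability `exp(-rx)`; other `x` give trivial events.
  refine Measure.ext_of_Ici _ _ fun x => ?_
  rw [← measureReal_eq_measureReal_iff, map_measureReal_apply hm1 measurableSet_Ici,
    map_measureReal_apply hm2 measurableSet_Ici]
  rcases lt_or_ge ((t : ℝ) - u) x with hx | hx
  · have h1 : (fun ω => (t : ℝ) - (max (lastSample N t ω) u : ℝ≥0)) ⁻¹' Set.Ici x = ∅ := by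
      refine Set.eq_empty_of_forall_notMem fun ω h => ?_
      have h2 : (u : ℝ) ≤ (max (lastSample N t ω) u : ℝ≥0) := NNReal.coe_le_coe.2 (le_max_right _ _)
      simp only [Set.mem_preimage, Set.mem_Ici] at h
      linarith
    have h2 : (fun y : ℝ => min y ((t : ℝ) - u)) ⁻¹' Set.Ici x = ∅ := by
      refine Set.eq_empty_of_forall_notMem fun y h => ?_
      simp only [Set.mem_preimage, Set.mem_Ici, le_min_iff] at h
      linarith
    rw [h1, h2]; simp
  have h2 : (fun y : ℝ => min y ((t : ℝ) - u)) ⁻¹' Set.Ici x = Set.Ici x := by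
    ext y; simp [hx]
  rw [h2, measureReal_expMeasure_Ici hr]
  split_ifs with h0
  · have hb : (((t : ℝ) - x).toNNReal : ℝ) = t - x := Real.coe_toNNReal _ (by
      have := u.2; simp only [NNReal.val_eq_coe] at this; linarith)
    have hbt : ((t : ℝ) - x).toNNReal ≤ t := by
      rw [← NNReal.coe_le_coe, hb]; linarith
    have hub : u ≤ ((t : ℝ) - x).toNNReal := by
      rw [← NNReal.coe_le_coe, hb]; linarith
    have h1 : (fun ω => (t : ℝ) - (max (lastSample N t ω) u : ℝ≥0)) ⁻¹' Set.Ici x =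
        {ω | lastSample N t ω ≤ ((t : ℝ) - x).toNNReal} := by
      ext ω
      have : x ≤ (t : ℝ) - (max (lastSample N t ω) u : ℝ≥0) ↔
          max (lastSample N t ω) u ≤ ((t : ℝ) - x).toNNReal := by
        rw [← NNReal.coe_le_coe, hb]
        constructor <;> intro h <;> linarith
      simp only [Set.mem_preimage, Set.mem_Ici, this, max_le_iff, hub, and_true,
        Set.mem_ofPred_eq]
    rw [h1, hN.measureReal_lastSample_le hr hbt, hb, sub_sub_cancel]
  · have h1 : (fun ω => (t : ℝ) - (max (lastSample N t ω) u : ℝ≥0)) ⁻¹' Set.Ici x = Set.univ := by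
      refine Set.eq_univ_of_forall fun ω => ?_
      have h2 : ((max (lastSample N t ω) u : ℝ≥0) : ℝ) ≤ t :=
        NNReal.coe_le_coe.2 (max_le (lastSample_le N t ω) hut)
      simp only [Set.mem_preimage, Set.mem_Ici]
      linarith
    rw [h1]; simp

/-! ### Decorrelation of the chain -/

lemma integral_comp_fintype {Ω α : Type*} [MeasurableSpace Ω] [Fintype α] [MeasurableSpace α]
    [MeasurableSingletonClass α] {μ : Measure Ω} [IsProbabilityMeasure μ] {V : Ω → α}
    (hV : Measurable V) (h : α → ℝ) :
    ∫ ω, h (V ω) ∂μ = ∑ v, μ.real (V ⁻¹' {v}) * h v := by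
  have := Measure.isProbabilityMeasure_map (μ := μ) hV.aemeasurable
  have hm : Measurable h := measurable_of_countable h
  rw [← integral_map hV.aemeasurable hm.aestronglyMeasurable,
    integral_fintype (Integrable.of_finite)]
  refine Finset.sum_congr rfl fun v _ => ?_
  rw [map_measureReal_apply hV (measurableSet_singleton v), smul_eq_mul]

noncomputable section

/-- The conditional mean of `p (X t) (X 0)` given `X 0 = k`. -/
def predictedMean {K : ℕ} (Q p : Matrix (Fin K) (Fin K) ℝ) (t : ℝ) (k : Fin K) : ℝ :=
  ∑ l, transition Q t k l * p l k

/-- The mean of `p (X t) (X 0)` for the stationary chain. -/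
def stationaryMean {K : ℕ} (Q : Matrix (Fin K) (Fin K) ℝ) (π : Fin K → ℝ)
    (p : Matrix (Fin K) (Fin K) ℝ) (t : ℝ) : ℝ :=
  ∑ k, π k * predictedMean Q p t k

/-- The mean of `stationaryMean` at an exponentially distributed age. -/
def sampledMean {K : ℕ} (Q : Matrix (Fin K) (Fin K) ℝ) (π : Fin K → ℝ) (r : ℝ)
    (p : Matrix (Fin K) (Fin K) ℝ) : ℝ :=
  ∫ t, stationaryMean Q π p t ∂expMeasure r

end

section Chain

variable {K : ℕ} {Q p q : Matrix (Fin K) (Fin K) ℝ} {π : Fin K → ℝ}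

lemma IsGenerator.abs_predictedMean_le (hQ : IsGenerator Q) (hp : ∀ i j, |p i j| ≤ 1) {t : ℝ}
    (ht : 0 ≤ t) (k : Fin K) : |predictedMean Q p t k| ≤ 1 := by
  rw [← hQ.transition_sum t k]
  refine (Finset.abs_sum_le_sum_abs _ _).trans (Finset.sum_le_sum fun l _ => ?_)
  rw [abs_mul, abs_of_nonneg (hQ.transition_nonneg ht k l)]
  exact mul_le_of_le_one_right (hQ.transition_nonneg ht k l) (hp l k)

lemma IsGenerator.abs_stationaryMean_le (hQ : IsGenerator Q) (hπ : IsStationary Q π)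
    (hp : ∀ i j, |p i j| ≤ 1) {t : ℝ} (ht : 0 ≤ t) : |stationaryMean Q π p t| ≤ 1 := by
  rw [← hπ.sum_eq_one]
  refine (Finset.abs_sum_le_sum_abs _ _).trans (Finset.sum_le_sum fun k _ => ?_)
  rw [abs_mul, abs_of_nonneg (hπ.nonneg k)]
  exact mul_le_of_le_one_right (hπ.nonneg k) (hQ.abs_predictedMean_le hp ht k)

lemma continuous_stationaryMean (Q : Matrix (Fin K) (Fin K) ℝ) (π : Fin K → ℝ)
    (p : Matrix (Fin K) (Fin K) ℝ) : Continuous (stationaryMean Q π p) := by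
  unfold stationaryMean predictedMean
  have := continuous_transition_apply Q
  fun_prop

variable {Ω : Type*} [MeasurableSpace Ω] {μ : Measure Ω} {X : ℝ≥0 → Ω → Fin K}

lemma IsCTMC.measureReal_four (hX : IsCTMC μ Q X) {a s b t : ℝ≥0} (has : a ≤ s) (hsb : s ≤ b)
    (hbt : b ≤ t) (j i k l : Fin K) :
    μ.real ((fun ω => (X a ω, X s ω, X b ω, X t ω)) ⁻¹' {(j, i, k, l)}) =
      μ.real ((fun ω => (X a ω, X s ω)) ⁻¹' {(j, i)}) *
        transition Q ((b : ℝ) - s) i k * transition Q ((t : ℝ) - b) k l := by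
  let τ : ℕ → ℝ≥0
    | 0 => a
    | 1 => s
    | 2 => b
    | _ => t
  have hτ : Monotone τ := by
    refine monotone_nat_of_le_succ fun m => ?_
    match m with
    | 0 => exact has
    | 1 => exact hsb
    | 2 => exact hbt
    | m + 3 => exact le_rfl
  let x : ℕ → Fin K
    | 0 => j
    | 1 => i
    | 2 => k
    | _ => l
  have h2 : (fun ω => (X a ω, X s ω)) ⁻¹' {(j, i)} = {ω | ∀ m ≤ 1, X (τ m) ω = x m} := by
    ext ω
    simp only [Set.mem_preimage, Set.mem_singleton_iff, Prod.mk.injEq, Set.mem_ofPred_eq]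
    refine ⟨fun h m hm => ?_, fun h => ⟨h 0 (by norm_num), h 1 le_rfl⟩⟩
    interval_cases m
    exacts [h.1, h.2]
  have h4 : (fun ω => (X a ω, X s ω, X b ω, X t ω)) ⁻¹' {(j, i, k, l)} =
      {ω | ∀ m ≤ 3, X (τ m) ω = x m} := by
    ext ω
    simp only [Set.mem_preimage, Set.mem_singleton_iff, Prod.mk.injEq, Set.mem_ofPred_eq]
    refine ⟨fun h m hm => ?_, fun h => ⟨h 0 (by norm_num), h 1 (by norm_num), h 2 (by norm_num),
      h 3 le_rfl⟩⟩
    interval_cases m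
    exacts [h.1, h.2.1, h.2.2.1, h.2.2.2]
  rw [h4, h2, hX.markov 2 τ x hτ, hX.markov 1 τ x hτ]
  rfl

/-- The values of the chain after time `b` are almost independent of those up to time `s`. -/
lemma IsCTMC.abs_integral_mul_sub_le [IsProbabilityMeasure μ] (hX : IsCTMC μ Q X)
    (hQ : IsGenerator Q) {C c : ℝ} (hmix : ∀ t, 0 ≤ t → ∀ i j,
      |transition Q t i j - π j| ≤ C * Real.exp (-(c * t)))
    (hp : ∀ i j, |p i j| ≤ 1) (hq : ∀ i j, |q i j| ≤ 1) {a s b t : ℝ≥0}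
    (has : a ≤ s) (hsb : s ≤ b) (hbt : b ≤ t) :
    |∫ ω, q (X s ω) (X a ω) * p (X t ω) (X b ω) ∂μ -
      (∫ ω, q (X s ω) (X a ω) ∂μ) * stationaryMean Q π p ((t : ℝ) - b)| ≤
      K * (C * Real.exp (-(c * ((b : ℝ) - s)))) := by
  have hsb' : 0 ≤ (b : ℝ) - s := sub_nonneg.2 (NNReal.coe_le_coe.2 hsb)
  have hbt' : 0 ≤ (t : ℝ) - b := sub_nonneg.2 (NNReal.coe_le_coe.2 hbt)
  have hV2 : Measurable fun ω => (X a ω, X s ω) := (hX.measurable a).prodMk (hX.measurable s)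
  have hV4 : Measurable fun ω => (X a ω, X s ω, X b ω, X t ω) :=
    (hX.measurable a).prodMk ((hX.measurable s).prodMk
      ((hX.measurable b).prodMk (hX.measurable t)))
  set m : Fin K × Fin K → ℝ := fun v => μ.real ((fun ω => (X a ω, X s ω)) ⁻¹' {v}) with hm
  have h2 : ∫ ω, q (X s ω) (X a ω) ∂μ = ∑ v, m v * q v.2 v.1 :=
    integral_comp_fintype hV2 fun v => q v.2 v.1
  have hm1 : ∑ v, m v = 1 := by
    have := integral_comp_fintype (μ := μ) hV2 fun _ => 1
    simpa using this.symm
  have h4 : ∫ ω, q (X s ω) (X a ω) * p (X t ω) (X b ω) ∂μ =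
      ∑ v, m v * q v.2 v.1 * ∑ k, transition Q ((b : ℝ) - s) v.2 k *
        predictedMean Q p ((t : ℝ) - b) k := by
    rw [integral_comp_fintype hV4 fun v => q v.2.1 v.1 * p v.2.2.2 v.2.2.1]
    simp only [Fintype.sum_prod_type, hX.measureReal_four has hsb hbt, predictedMean,
      Finset.mul_sum]
    refine Finset.sum_congr rfl fun j _ => Finset.sum_congr rfl fun i _ =>
      Finset.sum_congr rfl fun k _ => Finset.sum_congr rfl fun l _ => ?_
    ring
  -- Only the transition from `s` to `b` is replaced by `π`. The remaining factors are bounded by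
  -- `1` and the weights `m v` sum to `1`, so the error is at most that of `K` matrix entries.
  have hdiff : ∫ ω, q (X s ω) (X a ω) * p (X t ω) (X b ω) ∂μ -
      (∫ ω, q (X s ω) (X a ω) ∂μ) * stationaryMean Q π p ((t : ℝ) - b) =
      ∑ v, m v * (q v.2 v.1 * ∑ k, (transition Q ((b : ℝ) - s) v.2 k - π k) *
        predictedMean Q p ((t : ℝ) - b) k) := by
    rw [h4, h2, stationaryMean, Finset.sum_mul, ← Finset.sum_sub_distrib]
    simp only [sub_mul, Finset.sum_sub_distrib, mul_sub, mul_assoc]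
  rw [hdiff, ← one_mul ((K : ℝ) * _), ← hm1, Finset.sum_mul]
  refine (Finset.abs_sum_le_sum_abs _ _).trans (Finset.sum_le_sum fun v _ => ?_)
  rw [abs_mul, abs_of_nonneg (show 0 ≤ m v from measureReal_nonneg)]
  refine mul_le_mul_of_nonneg_left ?_ measureReal_nonneg
  rw [abs_mul]
  refine (mul_le_of_le_one_left (abs_nonneg _) (hq _ _)).trans
    ((Finset.abs_sum_le_sum_abs _ _).trans ?_)
  calc _ ≤ ∑ k : Fin K, C * Real.exp (-(c * ((b : ℝ) - s))) := by
        refine Finset.sum_le_sum fun k _ => ?_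
        rw [abs_mul]
        exact (mul_le_of_le_one_right (abs_nonneg _) (hQ.abs_predictedMean_le hp hbt' k)).trans
          (hmix _ hsb' _ _)
    _ = _ := by simp

end Chain

/-! ### Decorrelation of the sampled chain -/

section Sampled

variable {K : ℕ} {Q p q : Matrix (Fin K) (Fin K) ℝ} {π : Fin K → ℝ}
  {Ω : Type*} [MeasurableSpace Ω] {μ : Measure Ω} {X : ℝ≥0 → Ω → Fin K} {N : ℝ≥0 → Ω → ℕ} {r : ℝ}

/-- The path of the chain. -/
def IsCTMC.path (hX : IsCTMC μ Q X) (ω : Ω) : RightContPath K :=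
  ⟨fun t => X t ω, hX.right_continuous ω⟩

lemma IsCTMC.measurable_path (hX : IsCTMC μ Q X) : Measurable hX.path :=
  (measurable_pi_iff.2 hX.measurable).subtype_mk

/-- The chain is independent of every function of the query process. -/
lemma IsPoissonSampledCTMC.indepFun_path (h : IsPoissonSampledCTMC μ Q r X N) {β : Type*}
    [MeasurableSpace β] {Z : Ω → β}
    (hZ : Measurable[MeasurableSpace.comap (fun ω t => N t ω) inferInstance] Z) :
    IndepFun h.chain.path Z μ := by
  have h1 := (IndepFun_iff_Indep _ _ _).1 h.indep
  rw [IndepFun_iff_Indep]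
  refine indep_of_indep_of_le_left (indep_of_indep_of_le_right h1 hZ.comap_le) (le_of_eq ?_)
  change MeasurableSpace.comap _ (MeasurableSpace.comap _ _) = _
  rw [MeasurableSpace.comap_comp]
  rfl

lemma IsPoissonSampledCTMC.measurable_estimator (h : IsPoissonSampledCTMC μ Q r X N) (t : ℝ≥0) :
    Measurable (estimator X N t) :=
  (measurable_rightContPath_eval K).comp
    (h.chain.measurable_path.prodMk (h.queries.measurable_lastSample t))

lemma IsPoissonSampledCTMC.measurable_fwc (h : IsPoissonSampledCTMC μ Q r X N)
    (p : Matrix (Fin K) (Fin K) ℝ) (t : ℝ≥0) : Measurable (fwc p X N t) :=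
  (measurable_of_countable fun v : Fin K × Fin K => p v.1 v.2).comp
    ((h.chain.measurable t).prodMk (h.measurable_estimator t))

lemma IsPoissonSampledCTMC.fwc_right_continuous (h : IsPoissonSampledCTMC μ Q r X N)
    (p : Matrix (Fin K) (Fin K) ℝ) (ω : Ω) (t : ℝ≥0) :
    ContinuousWithinAt (fun s => fwc p X N s ω) (Set.Ici t) t := by
  refine tendsto_nhds_of_eventually_eq ?_
  filter_upwards [(h.chain.right_continuous ω t).tendsto.eventually (p := fun m => m = X t ω)
      (by simp),
    lastSample_eventuallyEq (h.queries.monotone ω) (h.queries.right_continuous ω) t] with x h1 h2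
  rw [fwc, fwc, estimator, estimator, h1, h2]

/-- The freshness at time `t` is almost independent of the past up to time `s`. -/
lemma IsPoissonSampledCTMC.abs_integral_fwc_mul_sub_le [IsProbabilityMeasure μ]
    (h : IsPoissonSampledCTMC μ Q r X N) (hQ : IsGenerator Q) (hπ : IsStationary Q π) (hr : 0 < r)
    {C c : ℝ} (hC : 0 ≤ C) (hc : 0 ≤ c) (hmix : ∀ t, 0 ≤ t → ∀ i j,
      |transition Q t i j - π j| ≤ C * Real.exp (-(c * t)))
    (hp : ∀ i j, |p i j| ≤ 1) (hq : ∀ i j, |q i j| ≤ 1) {s u t : ℝ≥0} (hsu : s ≤ u)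
    (hut : u ≤ t) :
    |∫ ω, fwc q X N s ω * fwc p X N t ω ∂μ - (∫ ω, fwc q X N s ω ∂μ) * sampledMean Q π r p| ≤
      K * (C * Real.exp (-(c * ((u : ℝ) - s)))) + 4 * Real.exp (-(r * ((t : ℝ) - u))) := by
  have hut' : (u : ℝ) ≤ t := NNReal.coe_le_coe.2 hut
  have := isProbabilityMeasure_expMeasure hr
  set L : Ω → ℝ≥0 := lastSample N s with hL
  -- Truncation at `u` keeps the second sampling time at distance at least `u - s` from `s`, for
  -- mixing, and makes it independent of the first.
  set τ : Ω → ℝ≥0 := fun ω => max (lastSample N t ω) u with hτ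
  have hLs : ∀ ω, L ω ≤ s := lastSample_le N s
  have hτt : ∀ ω, τ ω ≤ t := fun ω => max_le (lastSample_le N t ω) hut
  have huτ : ∀ ω, u ≤ τ ω := fun ω => le_max_right _ _
  have hLm : Measurable L := h.queries.measurable_lastSample s
  have hτm : Measurable τ := (h.queries.measurable_lastSample t).max measurable_const
  have hpm : Measurable fun v : Fin K × Fin K => p v.1 v.2 := measurable_of_countable _
  have hqm : Measurable fun v : Fin K × Fin K => q v.1 v.2 := measurable_of_countable _
  have hev := measurable_rightContPath_eval K
  have habs : ∀ {x y : ℝ}, |x| ≤ 1 → |y| ≤ 1 → |x * y| ≤ 1 := fun {x y} hx hy => by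
    rw [abs_mul]; exact mul_le_one₀ hx (abs_nonneg y) hy
  -- replacing the sampling time `lastSample N t` by `τ`
  set F' : Ω → ℝ := fun ω => p (X t ω) (X (τ ω) ω) with hF'
  have hF'm : Measurable F' := hpm.comp ((h.chain.measurable t).prodMk
    (hev.comp (h.chain.measurable_path.prodMk hτm)))
  have hqF : ∀ ω, |fwc q X N s ω| ≤ 1 := fun ω => hq _ _
  have hbdd : ∀ {f : Ω → ℝ}, Measurable f → (∀ ω, |f ω| ≤ 1) → Integrable f μ :=
    fun hf hb => Integrable.of_bound hf.aestronglyMeasurable 1 (ae_of_all _ hb)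
  have hi1 : Integrable (fun ω => fwc q X N s ω * fwc p X N t ω) μ :=
    hbdd ((h.measurable_fwc q s).mul (h.measurable_fwc p t)) fun ω => habs (hqF ω) (hp _ _)
  have hi2 : Integrable (fun ω => fwc q X N s ω * F' ω) μ :=
    hbdd ((h.measurable_fwc q s).mul hF'm) fun ω => habs (hqF ω) (hp _ _)
  -- The integrands can differ, by at most `2`, only when there is no sample in `(u, t]`.
  have hstep1 : |∫ ω, fwc q X N s ω * fwc p X N t ω ∂μ - ∫ ω, fwc q X N s ω * F' ω ∂μ| ≤
      2 * Real.exp (-(r * ((t : ℝ) - u))) := by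
    have hms : MeasurableSet {ω | lastSample N t ω ≤ u} :=
      h.queries.measurable_lastSample t measurableSet_Iic
    rw [← integral_sub hi1 hi2, ← h.queries.measureReal_lastSample_le hr hut, mul_comm,
      ← smul_eq_mul, ← integral_indicator_const _ hms, ← Real.norm_eq_abs]
    refine norm_integral_le_of_norm_le ((integrable_const 2).indicator hms)
      (ae_of_all _ fun ω => ?_)
    by_cases hω : lastSample N t ω ≤ u
    · rw [Set.indicator_of_mem (show ω ∈ {ω | lastSample N t ω ≤ u} from hω), Real.norm_eq_abs]
      refine (abs_sub _ _).trans ?_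
      have h1 := habs (hqF ω) (hp (X t ω) (estimator X N t ω))
      have h2 := habs (hqF ω) (hp (X t ω) (X (τ ω) ω))
      simp only [fwc, hF'] at h1 h2 ⊢
      linarith
    · have hτω : τ ω = lastSample N t ω := max_eq_left (not_le.1 hω).le
      rw [Set.indicator_of_notMem (show ω ∉ {ω | lastSample N t ω ≤ u} from hω), hF']
      simp [hτω, fwc, estimator]
  -- conditioning on the sampling times
  set φ : ℝ≥0 × ℝ≥0 → ℝ := fun z => ∫ ω, q (X s ω) (X z.1 ω) * p (X t ω) (X z.2 ω) ∂μ with hφ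
  set ψ : ℝ≥0 → ℝ := fun a => ∫ ω, q (X s ω) (X a ω) ∂μ with hψ
  have hLτ : Measurable[MeasurableSpace.comap (fun ω t => N t ω) inferInstance]
      fun ω => (L ω, τ ω) :=
    (h.queries.measurable_lastSample_comap s).prodMk
      ((h.queries.measurable_lastSample_comap t).max measurable_const)
  have hqmeas : Measurable fun z : RightContPath K × ℝ≥0 => q (z.1.1 s) (z.1.1 z.2) :=
    hqm.comp ((hev.comp (measurable_fst.prodMk measurable_const)).prodMk hev)
  have hpmeas : Measurable fun z : RightContPath K × ℝ≥0 => p (z.1.1 t) (z.1.1 z.2) :=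
    hpm.comp ((hev.comp (measurable_fst.prodMk measurable_const)).prodMk hev)
  have hstep2 : ∫ ω, fwc q X N s ω * F' ω ∂μ = ∫ ω, φ (L ω, τ ω) ∂μ :=
    integral_indepFun_prod h.chain.measurable_path (hLm.prodMk hτm) (h.indepFun_path hLτ)
      (Φ := fun z : RightContPath K × ℝ≥0 × ℝ≥0 =>
        q (z.1.1 s) (z.1.1 z.2.1) * p (z.1.1 t) (z.1.1 z.2.2))
      ((hqmeas.comp (measurable_fst.prodMk (measurable_fst.comp measurable_snd))).mul
        (hpmeas.comp (measurable_fst.prodMk (measurable_snd.comp measurable_snd))))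
      fun z => habs (hq _ _) (hp _ _)
  have hstep3 : ∫ ω, fwc q X N s ω ∂μ = ∫ ω, ψ (L ω) ∂μ :=
    integral_indepFun_prod h.chain.measurable_path hLm
      (h.indepFun_path (h.queries.measurable_lastSample_comap s))
      (Φ := fun z : RightContPath K × ℝ≥0 => q (z.1.1 s) (z.1.1 z.2)) hqmeas fun z => hq _ _
  have hφm : Measurable φ := by
    have : StronglyMeasurable fun z : (ℝ≥0 × ℝ≥0) × Ω =>
        q (X s z.2) (X z.1.1 z.2) * p (X t z.2) (X z.1.2 z.2) := by
      refine Measurable.stronglyMeasurable ?_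
      exact (hqmeas.comp ((h.chain.measurable_path.comp measurable_snd).prodMk
        (measurable_fst.comp measurable_fst))).mul (hpmeas.comp
          ((h.chain.measurable_path.comp measurable_snd).prodMk
            (measurable_snd.comp measurable_fst)))
    exact this.integral_prod_right.measurable
  have hψm : Measurable ψ := by
    have : StronglyMeasurable fun z : ℝ≥0 × Ω => q (X s z.2) (X z.1 z.2) := by
      refine Measurable.stronglyMeasurable ?_
      exact hqmeas.comp ((h.chain.measurable_path.comp measurable_snd).prodMk measurable_fst)
    exact this.integral_prod_right.measurable
  have habs_int : ∀ {f : Ω → ℝ}, (∀ ω, |f ω| ≤ 1) → |∫ ω, f ω ∂μ| ≤ 1 := fun {f} hf => by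
    simpa using norm_integral_le_of_norm_le_const (μ := μ) (f := f) (C := 1) (ae_of_all _ hf)
  have hψ1 : ∀ a, |ψ a| ≤ 1 := fun a => habs_int fun ω => hq _ _
  have hφ1 : ∀ z, |φ z| ≤ 1 := fun z => habs_int fun ω => habs (hq _ _) (hp _ _)
  set G : ℝ → ℝ := stationaryMean Q π p with hG
  have hGc : Continuous G := continuous_stationaryMean Q π p
  have hage : ∀ ω, 0 ≤ (t : ℝ) - τ ω := fun ω => sub_nonneg.2 (NNReal.coe_le_coe.2 (hτt ω))
  have hG1 : ∀ x, 0 ≤ x → |G x| ≤ 1 := fun x hx => hQ.abs_stationaryMean_le hπ hp hx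
  have hagem : Measurable fun ω => (t : ℝ) - τ ω := measurable_const.sub hτm.coe_nnreal_real
  have hGm : Measurable fun ω => G ((t : ℝ) - τ ω) := hGc.measurable.comp hagem
  have hstep4 : |∫ ω, φ (L ω, τ ω) ∂μ - ∫ ω, ψ (L ω) * G ((t : ℝ) - τ ω) ∂μ| ≤
      K * (C * Real.exp (-(c * ((u : ℝ) - s)))) := by
    have hi3 : Integrable (fun ω => φ (L ω, τ ω)) μ :=
      hbdd (hφm.comp (hLm.prodMk hτm)) fun ω => hφ1 _
    have hi4 : Integrable (fun ω => ψ (L ω) * G ((t : ℝ) - τ ω)) μ :=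
      hbdd ((hψm.comp hLm).mul hGm) fun ω => habs (hψ1 _) (hG1 _ (hage ω))
    rw [← integral_sub hi3 hi4]
    have := norm_integral_le_of_norm_le_const (μ := μ)
      (f := fun ω => φ (L ω, τ ω) - ψ (L ω) * G ((t : ℝ) - τ ω))
      (C := K * (C * Real.exp (-(c * ((u : ℝ) - s))))) (ae_of_all _ fun ω => ?_)
    · simpa using this
    refine (h.chain.abs_integral_mul_sub_le hQ hmix hp hq (hLs ω) (hsu.trans (huτ ω))
      (hτt ω)).trans ?_
    have : (u : ℝ) ≤ τ ω := NNReal.coe_le_coe.2 (huτ ω)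
    gcongr
  -- independence of the two sampling times, and the law of the age
  have hstep5 : ∫ ω, ψ (L ω) * G ((t : ℝ) - τ ω) ∂μ =
      (∫ ω, ψ (L ω) ∂μ) * ∫ ω, G ((t : ℝ) - τ ω) ∂μ :=
    ((h.queries.indepFun_lastSample hsu).comp hψm
      (hGc.measurable.comp (measurable_const.sub measurable_id.coe_nnreal_real) :
        Measurable fun x : ℝ≥0 => G ((t : ℝ) - x))).integral_mul_eq_mul_integral
      (hψm.comp hLm).aestronglyMeasurable hGm.aestronglyMeasurable
  have hminm : Measurable fun x : ℝ => min x ((t : ℝ) - u) := by fun_prop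
  have hstep6 : ∫ ω, G ((t : ℝ) - τ ω) ∂μ = ∫ x, G (min x ((t : ℝ) - u)) ∂expMeasure r := by
    rw [← integral_map hagem.aemeasurable hGc.aestronglyMeasurable, h.queries.map_age hr hut,
      integral_map hminm.aemeasurable hGc.aestronglyMeasurable]
  have hnn := expMeasure_ae_nonneg hr
  have hmin : ∀ {x : ℝ}, 0 ≤ x → 0 ≤ min x ((t : ℝ) - u) := fun hx =>
    le_min hx (sub_nonneg.2 hut')
  -- Removing the truncation of the age costs `2` times an exponential tail, the other half of the
  -- constant `4`.
  have hstep7 : |∫ x, G (min x ((t : ℝ) - u)) ∂expMeasure r - sampledMean Q π r p| ≤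
      2 * Real.exp (-(r * ((t : ℝ) - u))) := by
    have hi5 : Integrable (fun x => G (min x ((t : ℝ) - u))) (expMeasure r) :=
      Integrable.of_bound (hGc.measurable.comp hminm).aestronglyMeasurable 1
        (hnn.mono fun x hx => hG1 _ (hmin hx))
    rw [sampledMean, ← integral_sub hi5
      (Integrable.of_bound hGc.aestronglyMeasurable 1 (hnn.mono hG1))]
    have hexp := measureReal_expMeasure_Ici hr ((t : ℝ) - u)
    rw [if_pos (sub_nonneg.2 hut')] at hexp
    rw [← hexp, mul_comm, ← smul_eq_mul, ← integral_indicator_const _ measurableSet_Ici,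
      ← Real.norm_eq_abs]
    refine norm_integral_le_of_norm_le ((integrable_const 2).indicator measurableSet_Ici)
      (hnn.mono fun x hx => ?_)
    by_cases hx' : x ∈ Set.Ici ((t : ℝ) - u)
    · rw [Set.indicator_of_mem hx', Real.norm_eq_abs]
      refine (abs_sub _ _).trans ?_
      have h1 := hG1 _ (hmin hx)
      have h2 := hG1 _ hx
      linarith
    · rw [Set.indicator_of_notMem hx', min_eq_left (not_le.1 hx').le]
      simp [hG]
  have hE1 : |∫ ω, fwc q X N s ω ∂μ| ≤ 1 := habs_int hqF
  have hstep8 : |(∫ ω, fwc q X N s ω ∂μ) * (∫ x, G (min x ((t : ℝ) - u)) ∂expMeasure r -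
      sampledMean Q π r p)| ≤ 2 * Real.exp (-(r * ((t : ℝ) - u))) := by
    rw [abs_mul]
    exact (mul_le_of_le_one_left (abs_nonneg _) hE1).trans hstep7
  rw [hstep5, ← hstep3, hstep6] at hstep4
  rw [hstep2] at hstep1
  rw [mul_sub] at hstep8
  rw [abs_le] at hstep1 hstep4 hstep8 ⊢
  constructor <;> linarith [hstep1.1, hstep1.2, hstep4.1, hstep4.2, hstep8.1, hstep8.2]

/-- The freshness process decorrelates exponentially fast. -/
lemma IsPoissonSampledCTMC.exists_abs_integral_fwc_mul_sub_le [IsProbabilityMeasure μ]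
    (h : IsPoissonSampledCTMC μ Q r X N) (hQ : IsGenerator Q) (hπ : IsStationary Q π) (hr : 0 < r)
    {C c : ℝ} (hC : 0 ≤ C) (hc : 0 < c) (hmix : ∀ t, 0 ≤ t → ∀ i j,
      |transition Q t i j - π j| ≤ C * Real.exp (-(c * t))) :
    ∃ D e : ℝ, 0 ≤ D ∧ 0 < e ∧ ∀ p q : Matrix (Fin K) (Fin K) ℝ, (∀ i j, |p i j| ≤ 1) →
      (∀ i j, |q i j| ≤ 1) → ∀ s t : ℝ≥0, s ≤ t →
      |∫ ω, fwc q X N s ω * fwc p X N t ω ∂μ - (∫ ω, fwc q X N s ω ∂μ) * sampledMean Q π r p| ≤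
        D * Real.exp (-(e * ((t : ℝ) - s))) := by
  -- Taking `u` to be the midpoint of `s` and `t` shares the gap between mixing and sampling, whence
  -- the factor `1/2` in the rate.
  refine ⟨K * C + 4, min c r / 2, by positivity, by positivity, fun p q hp hq s t hst => ?_⟩
  have hst' : (s : ℝ) ≤ t := NNReal.coe_le_coe.2 hst
  have hu : (((s + t) / 2 : ℝ≥0) : ℝ) = (s + t) / 2 := by push_cast; rfl
  have hsu : s ≤ (s + t) / 2 := by rw [← NNReal.coe_le_coe, hu]; linarith
  have hut : (s + t) / 2 ≤ t := by rw [← NNReal.coe_le_coe, hu]; linarith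
  refine (h.abs_integral_fwc_mul_sub_le hQ hπ hr hC hc.le hmix hp hq hsu hut).trans ?_
  rw [hu, add_mul, mul_assoc (K : ℝ)]
  have h1 : min c r / 2 * ((t : ℝ) - s) ≤ c * ((s + t) / 2 - s) := by
    nlinarith [mul_le_mul_of_nonneg_right (min_le_left c r) (sub_nonneg.2 hst')]
  have h2 : min c r / 2 * ((t : ℝ) - s) ≤ r * (t - (s + t) / 2) := by
    nlinarith [mul_le_mul_of_nonneg_right (min_le_right c r) (sub_nonneg.2 hst')]
  gcongr

end Sampled

/-! ### A law of large numbers for time averages -/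

section TimeAverage

lemma integral_exp_neg_mul_abs_sub {e : ℝ} (he : 0 < e) (s : ℝ) :
    Integrable (fun t : ℝ => Real.exp (-(e * |t - s|))) ∧
      ∫ t : ℝ, Real.exp (-(e * |t - s|)) = 2 / e := by
  have h1 : ∫ x : ℝ, Real.exp (-(e * |x|)) = 2 / e := by
    rw [integral_comp_abs (f := fun x => Real.exp (-(e * x)))]
    have h2 := integral_exp_mul_Ioi (neg_lt_zero.2 he) 0
    simp only [neg_mul] at h2
    rw [h2]
    simp only [mul_zero, neg_zero, Real.exp_zero]
    field_simp
  have h2 : Integrable fun x : ℝ => Real.exp (-(e * |x|)) :=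
    -- The integral of a non-integrable function is `0` by convention, so a nonzero value proves
    -- integrability.
    .of_integral_ne_zero (by rw [h1]; positivity)
  exact ⟨h2.comp_sub_right s,
    (integral_sub_right_eq_self (fun x : ℝ => Real.exp (-(e * |x|))) s).trans h1⟩

variable {Ω : Type*} [MeasurableSpace Ω] {μ : Measure Ω}
  {g : ℝ → Ω → ℝ} {D e : ℝ}

/-- The second moment is the double integral of the correlations over `[0, T]²`. For fixed `s` the
decay in `t` integrates over the whole line to `2 / e`, so the growth is only linear in `T`. -/
lemma integral_sq_intervalIntegral_le [IsProbabilityMeasure μ]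
    (hg : Measurable fun z : ℝ × Ω => g z.1 z.2)
    (hb : ∀ t ω, |g t ω| ≤ 1) (he : 0 < e)
    (hcov : ∀ s t, 0 ≤ s → s ≤ t → |∫ ω, g s ω * g t ω ∂μ| ≤ D * Real.exp (-(e * (t - s))))
    {T : ℝ} (hT : 0 ≤ T) :
    ∫ ω, (∫ t in (0 : ℝ)..T, g t ω) ^ 2 ∂μ ≤ D * (2 / e) * T := by
  set ν : Measure ℝ := volume.restrict (Set.Ioc 0 T) with hν
  have hD : 0 ≤ D := by
    have := (abs_nonneg _).trans (hcov 0 0 le_rfl le_rfl)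
    simpa using this
  have hbb : ∀ s t ω, |g s ω * g t ω| ≤ 1 := fun s t ω => by
    rw [abs_mul]; exact mul_le_one₀ (hb s ω) (abs_nonneg _) (hb t ω)
  have h1 : ∀ ω, (∫ t in (0 : ℝ)..T, g t ω) ^ 2 = ∫ z, g z.1 ω * g z.2 ω ∂ν.prod ν := by
    intro ω
    rw [intervalIntegral.integral_of_le hT, sq]
    exact (integral_prod_mul (μ := ν) (ν := ν) (fun t => g t ω) (fun t => g t ω)).symm
  have hm : Measurable fun z : Ω × ℝ × ℝ => g z.2.1 z.1 * g z.2.2 z.1 :=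
    (hg.comp (measurable_snd.fst.prodMk measurable_fst)).mul
      (hg.comp (measurable_snd.snd.prodMk measurable_fst))
  simp only [h1]
  rw [integral_integral_swap (Integrable.of_bound hm.aestronglyMeasurable 1
    (ae_of_all _ fun z => hbb _ _ _))]
  have hcov' : ∀ᵐ z ∂ν.prod ν, ‖∫ ω, g z.1 ω * g z.2 ω ∂μ‖ ≤
      D * Real.exp (-(e * |z.2 - z.1|)) := by
    rw [hν, Measure.prod_restrict]
    filter_upwards [ae_restrict_mem (measurableSet_Ioc.prod measurableSet_Ioc)] with z hz
    rw [Real.norm_eq_abs]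
    rcases le_total z.1 z.2 with h | h
    · rw [abs_of_nonneg (sub_nonneg.2 h)]
      exact hcov _ _ hz.1.1.le h
    · rw [abs_of_nonpos (sub_nonpos.2 h), neg_sub]
      simp only [mul_comm (g z.1 _)]
      exact hcov _ _ hz.2.1.le h
  have hi : Integrable (fun z : ℝ × ℝ => D * Real.exp (-(e * |z.2 - z.1|))) (ν.prod ν) := by
    refine Integrable.of_bound (C := D) (by fun_prop) (ae_of_all _ fun z => ?_)
    rw [Real.norm_of_nonneg (by positivity)]
    exact mul_le_of_le_one_right hD (Real.exp_le_one_iff.2 (neg_nonpos.2 (by positivity)))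
  refine (le_abs_self _).trans ((norm_integral_le_of_norm_le hi hcov').trans ?_)
  rw [integral_prod _ hi]
  have hle : ∀ s, ∫ t, D * Real.exp (-(e * |t - s|)) ∂ν ≤ D * (2 / e) := by
    intro s
    obtain ⟨h3, h4⟩ := integral_exp_neg_mul_abs_sub he s
    rw [integral_const_mul, ← h4]
    exact mul_le_mul_of_nonneg_left
      (setIntegral_le_integral h3 (ae_of_all _ fun _ => (Real.exp_pos _).le)) hD
  calc _ ≤ ∫ _, D * (2 / e) ∂ν := integral_mono hi.integral_prod_left (integrable_const _) hle
    _ = _ := by simp [hν, hT, mul_comm]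

/-- The sum of the squares has finite expectation, so it converges almost surely and its terms
vanish. -/
lemma ae_tendsto_zero_of_integral_sq_le {Y : ℕ → Ω → ℝ} (hm : ∀ k, Measurable (Y k))
    (hi : ∀ k, Integrable (fun ω => Y k ω ^ 2) μ) {b : ℕ → ℝ} (hb : Summable b)
    (hle : ∀ k, ∫ ω, Y k ω ^ 2 ∂μ ≤ b k) :
    ∀ᵐ ω ∂μ, Tendsto (fun k => Y k ω) atTop (𝓝 0) := by
  have hb0 : ∀ k, 0 ≤ b k := fun k => (integral_nonneg fun ω => sq_nonneg _).trans (hle k)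
  have h1 : ∫⁻ ω, ∑' k, ENNReal.ofReal (Y k ω ^ 2) ∂μ ≠ ⊤ := by
    rw [lintegral_tsum fun k => ((hm k).pow_const 2).ennreal_ofReal.aemeasurable]
    refine ne_top_of_le_ne_top (b := ∑' k, ENNReal.ofReal (b k)) hb.tsum_ofReal_ne_top
      (ENNReal.tsum_le_tsum fun k => ?_)
    rw [← ofReal_integral_eq_lintegral_ofReal (hi k) (ae_of_all _ fun ω => sq_nonneg _)]
    exact ENNReal.ofReal_le_ofReal (hle k)
  filter_upwards [ae_lt_top (Measurable.tsum fun k => ((hm k).pow_const 2).ennreal_ofReal) h1]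
    with ω hω
  have h2 := ENNReal.tendsto_atTop_zero_of_tsum_ne_top hω.ne
  have h3 : Tendsto (fun k => Y k ω ^ 2) atTop (𝓝 0) := by
    have := (ENNReal.tendsto_toReal ENNReal.zero_ne_top).comp h2
    simpa [Function.comp_def, ENNReal.toReal_ofReal (sq_nonneg _)] using this
  have h4 := h3.sqrt
  simp only [Real.sqrt_sq_eq_abs, Real.sqrt_zero] at h4
  exact (tendsto_zero_iff_abs_tendsto_zero _).2 h4

/-- A bounded function whose time averages converge to zero along the squares has time averages
converging to zero. -/
lemma tendsto_timeAverage_of_squares {f : ℝ → ℝ} (hf : Measurable f) (hb : ∀ t, |f t| ≤ 1)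
    (h : Tendsto (fun k : ℕ => (1 / (k : ℝ) ^ 2) * ∫ t in (0 : ℝ)..(k : ℝ) ^ 2, f t) atTop (𝓝 0)) :
    Tendsto (fun τ : ℝ => (1 / τ) * ∫ t in (0 : ℝ)..τ, f t) atTop (𝓝 0) := by
  have hint : ∀ a b, IntervalIntegrable f volume a b := fun a b =>
    (intervalIntegrable_const (c := (1 : ℝ))).mono_fun hf.aestronglyMeasurable
      (ae_of_all _ fun t => by simpa using hb t)
  have hk : Tendsto (fun τ : ℝ => ⌊√τ⌋₊) atTop atTop :=
    tendsto_nat_floor_atTop.comp Real.tendsto_sqrt_atTop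
  have hlim : Tendsto (fun k : ℕ => |(1 / (k : ℝ) ^ 2) * ∫ t in (0 : ℝ)..(k : ℝ) ^ 2, f t| +
      (2 * (k : ℝ)⁻¹ + (k : ℝ)⁻¹ * (k : ℝ)⁻¹)) atTop (𝓝 0) := by
    have h0 := tendsto_inv_atTop_nhds_zero_nat (𝕜 := ℝ)
    simpa using h.abs.add ((h0.const_mul 2).add (h0.mul h0))
  refine squeeze_zero_norm' ?_ (hlim.comp hk)
  filter_upwards [hk.eventually_ge_atTop 1, eventually_gt_atTop 0] with τ hkτ hτ
  simp only [Function.comp_apply]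
  set k : ℝ := ((⌊√τ⌋₊ : ℕ) : ℝ) with hkdef
  have hk1 : 1 ≤ k := by rw [hkdef]; exact_mod_cast hkτ
  have hk2 : k ^ 2 ≤ τ := by
    have := Nat.floor_le (Real.sqrt_nonneg τ)
    calc k ^ 2 ≤ √τ ^ 2 := by gcongr
      _ = τ := Real.sq_sqrt hτ.le
  have hk3 : τ ≤ (k + 1) ^ 2 := by
    have := (Nat.lt_floor_add_one √τ).le
    calc τ = √τ ^ 2 := (Real.sq_sqrt hτ.le).symm
      _ ≤ (k + 1) ^ 2 := by gcongr
  have hsplit := intervalIntegral.integral_add_adjacent_intervals (hint 0 (k ^ 2)) (hint (k ^ 2) τ)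
  -- Here `k = ⌊√τ⌋`, and the gap between consecutive squares is negligible against `k ^ 2`.
  have hrest : |∫ t in (k ^ 2)..τ, f t| ≤ 2 * k + 1 := by
    have := intervalIntegral.norm_integral_le_of_norm_le_const (C := 1) (f := f) (a := k ^ 2)
      (b := τ) fun t _ => hb t
    rw [Real.norm_eq_abs, abs_of_nonneg (sub_nonneg.2 hk2)] at this
    nlinarith
  have hkpos : 0 < k ^ 2 := by positivity
  rw [← hsplit, Real.norm_eq_abs, abs_mul, abs_mul, abs_of_pos (one_div_pos.2 hτ),
    abs_of_pos (one_div_pos.2 hkpos)]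
  calc _ ≤ 1 / k ^ 2 * (|∫ t in (0 : ℝ)..k ^ 2, f t| + (2 * k + 1)) := by
        gcongr
        exact (abs_add_le _ _).trans (by gcongr)
    _ = _ := by field_simp

/-- Time averages of a bounded process with exponentially decaying correlations vanish. -/
lemma ae_tendsto_timeAverage_zero [IsProbabilityMeasure μ]
    (hg : Measurable fun z : ℝ × Ω => g z.1 z.2)
    (hb : ∀ t ω, |g t ω| ≤ 1) (he : 0 < e)
    (hcov : ∀ s t, 0 ≤ s → s ≤ t → |∫ ω, g s ω * g t ω ∂μ| ≤ D * Real.exp (-(e * (t - s)))) :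
    ∀ᵐ ω ∂μ, Tendsto (fun τ : ℝ => (1 / τ) * ∫ t in (0 : ℝ)..τ, g t ω) atTop (𝓝 0) := by
  set I : ℝ → Ω → ℝ := fun T ω => ∫ t in (0 : ℝ)..T, g t ω with hI
  have hIm : ∀ T, 0 ≤ T → Measurable (I T) := fun T hT => by
    simp only [hI, intervalIntegral.integral_of_le hT]
    exact (hg.stronglyMeasurable.integral_prod_left).measurable
  have hIb : ∀ T, 0 ≤ T → ∀ ω, |I T ω| ≤ T := fun T hT ω => by
    have := intervalIntegral.norm_integral_le_of_norm_le_const (C := 1) (f := fun t => g t ω)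
      (a := 0) (b := T) fun t _ => hb t ω
    simpa [abs_of_nonneg hT] using this
  have hY : ∀ᵐ ω ∂μ, Tendsto (fun k : ℕ => (1 / (k : ℝ) ^ 2) * I ((k : ℝ) ^ 2) ω) atTop (𝓝 0) := by
    -- A variance of order `1 / T` is summable along `T = k ^ 2`; at `k = 0` both sides are `0`
    -- because division by zero gives `0`.
    refine ae_tendsto_zero_of_integral_sq_le (b := fun k => D * (2 / e) * (1 / (k : ℝ) ^ 2))
      (fun k => (hIm _ (by positivity)).const_mul _) (fun k => ?_)
      ((Real.summable_one_div_nat_pow.2 one_lt_two).mul_left _) fun k => ?_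
    · refine Integrable.of_bound (C := (1 / (k : ℝ) ^ 2 * (k : ℝ) ^ 2) ^ 2)
        (((hIm _ (by positivity)).const_mul _).pow_const 2).aestronglyMeasurable
        (ae_of_all _ fun ω => ?_)
      rw [norm_pow, Real.norm_eq_abs, abs_mul, abs_of_nonneg (by positivity : 0 ≤ 1 / (k : ℝ) ^ 2)]
      have := hIb ((k : ℝ) ^ 2) (by positivity) ω
      gcongr
    · simp only [mul_pow]
      rw [integral_const_mul]
      have := integral_sq_intervalIntegral_le hg hb he hcov (T := (k : ℝ) ^ 2) (by positivity)
      refine (mul_le_mul_of_nonneg_left this (by positivity)).trans (le_of_eq ?_)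
      rcases eq_or_ne (k : ℝ) 0 with hk | hk
      · simp [hk]
      · field_simp
  filter_upwards [hY] with ω hω
  exact tendsto_timeAverage_of_squares (hg.comp measurable_prodMk_right) (fun t => hb t ω) hω

end TimeAverage

/-! ### The mean freshness -/

section MeanFreshness

variable {K : ℕ} {Q : Matrix (Fin K) (Fin K) ℝ} {π : Fin K → ℝ}
  {Ω : Type*} [MeasurableSpace Ω] {μ : Measure Ω} [IsProbabilityMeasure μ]
  {X : ℝ≥0 → Ω → Fin K} {N : ℝ≥0 → Ω → ℕ} {r : ℝ}

lemma tendsto_of_abs_sub_le_exp {f : ℝ≥0 → ℝ} {m D e : ℝ} (he : 0 < e)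
    (h : ∀ t : ℝ≥0, |f t - m| ≤ D * Real.exp (-(e * t))) : Tendsto f atTop (𝓝 m) := by
  rw [tendsto_iff_norm_sub_tendsto_zero]
  have h1 : Tendsto (fun t : ℝ≥0 => e * (t : ℝ)) atTop atTop :=
    (NNReal.tendsto_coe_atTop.2 tendsto_id).const_mul_atTop he
  have h2 := (Real.tendsto_exp_neg_atTop_nhds_zero.comp h1).const_mul D
  rw [mul_zero] at h2
  exact squeeze_zero (fun _ => norm_nonneg _) h h2

lemma IsPoissonSampledCTMC.integrable_fwc (h : IsPoissonSampledCTMC μ Q r X N)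
    (p : Matrix (Fin K) (Fin K) ℝ) (t : ℝ≥0) : Integrable (fwc p X N t) μ := by
  refine Integrable.of_bound (C := ∑ i, ∑ j, |p i j|) (h.measurable_fwc p t).aestronglyMeasurable
    (ae_of_all _ fun ω => ?_)
  have h1 := Finset.single_le_sum (f := fun j => |p (X t ω) j|) (fun j _ => abs_nonneg _)
    (Finset.mem_univ (estimator X N t ω))
  have h2 := Finset.single_le_sum (f := fun i => ∑ j, |p i j|)
    (fun i _ => Finset.sum_nonneg fun j _ => abs_nonneg _) (Finset.mem_univ (X t ω))
  exact h1.trans h2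

/-- The expected value of a function of the state and its estimate, as a combination of the
probabilities of the pairs of states. -/
lemma IsPoissonSampledCTMC.integral_fwc_eq_sum (h : IsPoissonSampledCTMC μ Q r X N)
    (p : Matrix (Fin K) (Fin K) ℝ) (t : ℝ≥0) :
    ∫ ω, fwc p X N t ω ∂μ =
      ∑ v : Fin K × Fin K, μ.real ((fun ω => (X t ω, estimator X N t ω)) ⁻¹' {v}) * p v.1 v.2 :=
  integral_comp_fintype ((h.chain.measurable t).prodMk (h.measurable_estimator t))
    fun v => p v.1 v.2

/-- If the mean of every function of the state and its estimate converges, then the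
fresh-when-close process has a steady state. -/
lemma IsPoissonSampledCTMC.exists_steady_state (h : IsPoissonSampledCTMC μ Q r X N)
    {M : Matrix (Fin K) (Fin K) ℝ → ℝ}
    (hM : ∀ p : Matrix (Fin K) (Fin K) ℝ, (∀ i j, |p i j| ≤ 1) →
      Tendsto (fun t => ∫ ω, fwc p X N t ω ∂μ) atTop (𝓝 (M p)))
    {P : Matrix (Fin K) (Fin K) ℝ} (hP : IsProximity P) :
    ∃ ν : Measure ℝ, IsProbabilityMeasure ν ∧
      (∀ v : ℝ, Tendsto (fun t : ℝ≥0 => μ.real {ω | fwc P X N t ω = v}) atTop (𝓝 (ν.real {v}))) ∧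
      ∫ x, x ∂ν = M P := by
  classical
  -- Matrices with a single entry `1` give the limiting joint law of the state and its estimate; `ν`
  -- is its image under `P`.
  set w : Fin K × Fin K → ℝ := fun v => M (Matrix.single v.1 v.2 1) with hw
  have hwlim : ∀ v, Tendsto (fun t => μ.real ((fun ω => (X t ω, estimator X N t ω)) ⁻¹' {v}))
      atTop (𝓝 (w v)) := by
    intro v
    refine (hM (Matrix.single v.1 v.2 1) fun i j => ?_).congr fun t => ?_
    · rw [Matrix.single_apply]; split_ifs <;> simp
    · rw [h.integral_fwc_eq_sum, Finset.sum_eq_single v]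
      · simp
      · intro u _ huv
        rw [Matrix.single_apply_of_ne, mul_zero]
        rintro ⟨h1, h2⟩
        exact huv (Prod.ext h1.symm h2.symm)
      · simp
  have hw0 : ∀ v, 0 ≤ w v := fun v => ge_of_tendsto' (hwlim v) fun _ => measureReal_nonneg
  have hMw : ∀ p : Matrix (Fin K) (Fin K) ℝ, (∀ i j, |p i j| ≤ 1) →
      M p = ∑ v, w v * p v.1 v.2 := by
    intro p hp
    refine tendsto_nhds_unique (hM p hp) ?_
    simp only [h.integral_fwc_eq_sum]
    exact tendsto_finsetSum _ fun v _ => (hwlim v).mul_const _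
  have hw1 : ∑ v, w v = 1 := by
    have h1 := hMw (Matrix.of fun _ _ => 1) (by simp)
    have h2 := hM (Matrix.of fun _ _ => 1) (by simp)
    simp only [fwc, Matrix.of_apply, integral_const, probReal_univ, smul_eq_mul, mul_one] at h1 h2
    rw [← h1, tendsto_nhds_unique h2 tendsto_const_nhds]
  set ν : Measure ℝ := ∑ v : Fin K × Fin K, ENNReal.ofReal (w v) • Measure.dirac (P v.1 v.2)
    with hν
  have hνp : IsProbabilityMeasure ν := by
    refine ⟨?_⟩
    simp only [hν, Measure.coe_finsetSum, Finset.sum_apply, Measure.smul_apply, measure_univ,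
      smul_eq_mul, mul_one]
    rw [← ENNReal.ofReal_sum_of_nonneg fun v _ => hw0 v, hw1, ENNReal.ofReal_one]
  refine ⟨ν, hνp, fun x => ?_, ?_⟩
  -- The probability of the value `x` is the mean of another freshness process, that of the level
  -- set of `P`.
  · set p : Matrix (Fin K) (Fin K) ℝ := Matrix.of fun i j => if P i j = x then 1 else 0 with hp
    have hp1 : ∀ i j, |p i j| ≤ 1 := fun i j => by
      rw [hp, Matrix.of_apply]; split_ifs <;> simp
    have hνx : ν.real {x} = M p := by
      rw [hMw p hp1, measureReal_def, hν]
      simp only [Measure.coe_finsetSum, Finset.sum_apply, Measure.smul_apply, smul_eq_mul,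
        Measure.dirac_apply' _ (measurableSet_singleton x)]
      rw [ENNReal.toReal_sum fun v _ => by
        by_cases hx : P v.1 v.2 ∈ ({x} : Set ℝ) <;> simp [hx]]
      refine Finset.sum_congr rfl fun v _ => ?_
      by_cases hx : P v.1 v.2 = x <;> simp [hp, hx, hw0 v]
    rw [hνx]
    refine (hM p hp1).congr fun t => ?_
    have hms : MeasurableSet {ω | fwc P X N t ω = x} :=
      h.measurable_fwc P t (measurableSet_singleton x)
    have hind : fwc p X N t = {ω | fwc P X N t ω = x}.indicator 1 := by
      funext ω
      simp [fwc, hp, Set.indicator_apply]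
    rw [hind, integral_indicator_one hms]
  · have hPb : ∀ i j, |P i j| ≤ 1 := fun i j => by
      rw [abs_of_nonneg (hP.nonneg i j)]; exact hP.le_one i j
    rw [hMw P hPb, hν, integral_finsetSum_measure fun v _ =>
      (integrable_dirac (by simp)).smul_measure ENNReal.ofReal_ne_top]
    refine Finset.sum_congr rfl fun v _ => ?_
    rw [integral_smul_measure, integral_dirac, ENNReal.toReal_ofReal (hw0 v), smul_eq_mul]

/-- The mean freshness of an exponentially mixing chain with Poisson sampling. -/
lemma IsPoissonSampledCTMC.isMeanFreshness (h : IsPoissonSampledCTMC μ Q r X N)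
    (hQ : IsGenerator Q) (hπ : IsStationary Q π) (hr : 0 < r)
    {C c : ℝ} (hC : 0 ≤ C) (hc : 0 < c) (hmix : ∀ t, 0 ≤ t → ∀ i j,
      |transition Q t i j - π j| ≤ C * Real.exp (-(c * t)))
    {P : Matrix (Fin K) (Fin K) ℝ} (hP : IsProximity P) :
    IsMeanFreshness μ (fwc P X N) (sampledMean Q π r P) := by
  obtain ⟨D, e, -, he, hDe⟩ := h.exists_abs_integral_fwc_mul_sub_le hQ hπ hr hC hc hmix
  have hlim : ∀ p : Matrix (Fin K) (Fin K) ℝ, (∀ i j, |p i j| ≤ 1) →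
      Tendsto (fun t => ∫ ω, fwc p X N t ω ∂μ) atTop (𝓝 (sampledMean Q π r p)) := by
    intro p hp
    refine tendsto_of_abs_sub_le_exp (D := D) he fun t => ?_
    -- With first factor `1` and `s = 0` the correlation estimate compares the mean at time `t` with
    -- its limit.
    simpa [fwc] using hDe p (Matrix.of fun _ _ => 1) hp (by simp) 0 t zero_le
  refine ⟨h.exists_steady_state hlim hP, ?_⟩
  have hPb : ∀ i j, |P i j| ≤ 1 := fun i j => by
    rw [abs_of_nonneg (hP.nonneg i j)]; exact hP.le_one i j
  set M : ℝ := sampledMean Q π r P with hM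
  have hM0 : 0 ≤ M := ge_of_tendsto' (hlim P hPb) fun t => integral_nonneg fun ω => hP.nonneg _ _
  have hM1 : M ≤ 1 := le_of_tendsto' (hlim P hPb) fun t => by
    have := integral_mono (h.integrable_fwc P t) (integrable_const 1) fun ω => hP.le_one _ _
    simpa using this
  -- Centring at the limit `M` suffices: the correlation of two `q`-freshnesses is exactly the left
  -- side of the estimate for the pair `P`, `q`.
  set q : Matrix (Fin K) (Fin K) ℝ := Matrix.of fun i j => P i j - M with hq
  have hqb : ∀ i j, |q i j| ≤ 1 := fun i j => by
    have h1 := hP.nonneg i j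
    have h2 := hP.le_one i j
    rw [hq, Matrix.of_apply, abs_le]
    constructor <;> linarith
  have hgm : Measurable fun z : ℝ × Ω => fwc q X N z.1.toNNReal z.2 :=
    (measurable_uncurry_of_right_continuous (h.measurable_fwc q) (h.fwc_right_continuous q)).comp
      (measurable_snd.prodMk measurable_fst.real_toNNReal)
  have hzero := ae_tendsto_timeAverage_zero (μ := μ) (g := fun t ω => fwc q X N t.toNNReal ω)
    (D := D) hgm (fun t ω => hqb _ _) he fun s t hs hst => by
      have h1 := hDe P q hPb hqb s.toNNReal t.toNNReal (Real.toNNReal_le_toNNReal hst)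
      rw [Real.coe_toNNReal s hs, Real.coe_toNNReal t (hs.trans hst)] at h1
      convert h1 using 2
      have hi : Integrable (fun ω => fwc q X N s.toNNReal ω * fwc P X N t.toNNReal ω) μ :=
        Integrable.of_bound (C := 1)
          ((h.measurable_fwc q _).mul (h.measurable_fwc P _)).aestronglyMeasurable
          (ae_of_all _ fun ω => by
            rw [Real.norm_eq_abs, abs_mul]
            exact mul_le_one₀ (hqb _ _) (abs_nonneg _) (hPb _ _))
      rw [← integral_mul_const, ← integral_sub hi ((h.integrable_fwc q _).mul_const M)]
      refine integral_congr_ae (ae_of_all _ fun ω => ?_)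
      simp only [fwc, hq, Matrix.of_apply]
      ring
  filter_upwards [hzero] with ω hω
  have h2 := hω.add_const M
  rw [zero_add] at h2
  refine h2.congr' ?_
  filter_upwards [eventually_gt_atTop 0] with τ hτ
  have hint : ∀ p : Matrix (Fin K) (Fin K) ℝ, (∀ i j, |p i j| ≤ 1) →
      IntervalIntegrable (fun t : ℝ => fwc p X N t.toNNReal ω) volume 0 τ := by
    intro p hp
    refine (intervalIntegrable_const (c := (1 : ℝ))).mono_fun ?_
      (ae_of_all _ fun t => by simpa [fwc] using hp _ _)
    exact ((measurable_uncurry_of_right_continuous (h.measurable_fwc p)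
      (h.fwc_right_continuous p)).comp
      (measurable_const.prodMk measurable_id.real_toNNReal)).aestronglyMeasurable
  have h3 : ∀ t : ℝ, fwc q X N t.toNNReal ω = fwc P X N t.toNNReal ω - M := fun t => rfl
  simp only [h3]
  rw [intervalIntegral.integral_sub (hint P hPb) intervalIntegrable_const,
    intervalIntegral.integral_const]
  simp only [sub_zero, smul_eq_mul]
  field_simp
  ring

end MeanFreshness

/-! ### Evaluation of the mean freshness -/

lemma integral_exp_neg_mul_expMeasure {r d : ℝ} (hr : 0 < r) (hd : 0 ≤ d) :
    ∫ t, Real.exp (-(d * t)) ∂expMeasure r = r / (r + d) := by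
  have h1 : ∫ t, Real.exp (-(d * t)) ∂expMeasure r =
      ∫ t, (exponentialPDF r t).toReal • Real.exp (-(d * t)) :=
    integral_withDensity_eq_integral_toReal_smul
      (measurable_exponentialPDFReal r).ennreal_ofReal (ae_of_all _ fun _ => ENNReal.ofReal_lt_top) _
  have h2 : (fun t => (exponentialPDF r t).toReal • Real.exp (-(d * t))) =
      (Set.Ici 0).indicator fun t => r * Real.exp (-(r + d) * t) := by
    funext t
    by_cases ht : 0 ≤ t
    · rw [Set.indicator_of_mem (Set.mem_Ici.2 ht), exponentialPDF_of_nonneg ht,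
        ENNReal.toReal_ofReal (by positivity), smul_eq_mul, mul_assoc, ← Real.exp_add]
      congr 2
      ring
    · rw [Set.indicator_of_notMem (by simpa using ht), exponentialPDF_of_neg (not_le.1 ht)]
      simp
  have hrd : 0 < r + d := by linarith
  rw [h1, h2, integral_indicator measurableSet_Ici, integral_Ici_eq_integral_Ioi,
    integral_const_mul, integral_exp_mul_Ioi (neg_lt_zero.2 hrd)]
  simp only [mul_zero, Real.exp_zero]
  field_simp

section Evaluation

variable {n : ℕ} {Q : Matrix (Fin (n + 1)) (Fin (n + 1)) ℝ} {π : Fin (n + 1) → ℝ}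
  {U P : Matrix (Fin (n + 1)) (Fin (n + 1)) ℝ} {d : Fin n → ℝ}

lemma coefB_eq_sum (π : Fin (n + 1) → ℝ) (U P : Matrix (Fin (n + 1)) (Fin (n + 1)) ℝ)
    (j : Fin n) : coefB π U P j = ∑ k, ∑ l, π k * (matT π U k j.castSucc *
      (matT π U)⁻¹ j.castSucc l * P l k) := by
  rw [coefB, dotProduct, Finset.sum_comm]
  refine Finset.sum_congr rfl fun l _ => ?_
  rw [Finset.sum_apply, Finset.mul_sum]
  refine Finset.sum_congr rfl fun k _ => ?_
  simp only [Matrix.row_apply, Pi.smul_apply, Matrix.col_apply, smul_eq_mul]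
  ring

/-- This is where `b_j` comes from: inserting the spectral form of the transition probabilities, it
is the coefficient of `exp(-d_j t)`. -/
lemma IsReversibleSetup.stationaryMean_eq (h : IsReversibleSetup Q π U d P) (t : ℝ) :
    stationaryMean Q π P t = π ⬝ᵥ (∑ i, π i • P.col i) +
      ∑ j, coefB π U P j * Real.exp (-(d j * t)) := by
  have h1 : π ⬝ᵥ (∑ i, π i • P.col i) = ∑ k, ∑ l, π k * (π l * P l k) := by
    rw [dotProduct, Finset.sum_comm]
    refine Finset.sum_congr rfl fun l _ => ?_
    rw [Finset.sum_apply, Finset.mul_sum]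
    refine Finset.sum_congr rfl fun k _ => ?_
    simp only [Pi.smul_apply, Matrix.col_apply, smul_eq_mul]
    ring
  have h2 : ∑ j, coefB π U P j * Real.exp (-(d j * t)) = ∑ k, ∑ l, ∑ j : Fin n,
      π k * (matT π U k j.castSucc * (matT π U)⁻¹ j.castSucc l * P l k) *
        Real.exp (-(d j * t)) := by
    simp only [coefB_eq_sum, Finset.sum_mul]
    rw [Finset.sum_comm]
    exact Finset.sum_congr rfl fun k _ => Finset.sum_comm
  rw [h1, h2, ← Finset.sum_add_distrib]
  refine Finset.sum_congr rfl fun k _ => ?_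
  rw [predictedMean, Finset.mul_sum, ← Finset.sum_add_distrib]
  refine Finset.sum_congr rfl fun l _ => ?_
  rw [h.diagonalization.transition_apply h.generator h.irreducible h.stationary, add_mul, mul_add,
    Finset.sum_mul, Finset.mul_sum]
  congr 1
  refine Finset.sum_congr rfl fun j _ => ?_
  ring

/-- At age `0` the estimate is exact, and the diagonal of `P` is `1`. -/
lemma IsReversibleSetup.sum_eq_one (h : IsReversibleSetup Q π U d P) :
    π ⬝ᵥ (∑ i, π i • P.col i) + ∑ j, coefB π U P j = 1 := by
  have h1 := h.stationaryMean_eq 0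
  simp only [mul_zero, neg_zero, Real.exp_zero, mul_one] at h1
  rw [← h1]
  simp [stationaryMean, predictedMean, transition_zero, Matrix.one_apply, h.proximity.diag,
    h.stationary.sum_eq_one]

lemma IsReversibleSetup.pos (h : IsReversibleSetup Q π U d P) (j : Fin n) : 0 < d j :=
  h.diagonalization.pos h.generator h.irreducible h.stationary j

lemma IsReversibleSetup.sampledMean_eq (h : IsReversibleSetup Q π U d P) {r : ℝ} (hr : 0 < r) :
    sampledMean Q π r P = π ⬝ᵥ (∑ i, π i • P.col i) + ∑ j, coefB π U P j * r / (r + d j) := by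
  have := isProbabilityMeasure_expMeasure hr
  have hi : ∀ j, Integrable (fun t => coefB π U P j * Real.exp (-(d j * t))) (expMeasure r) := by
    intro j
    refine (Integrable.of_bound (C := 1) (by fun_prop) ?_).const_mul _
    filter_upwards [expMeasure_ae_nonneg hr] with t ht
    rw [Real.norm_eq_abs, Real.abs_exp, Real.exp_le_one_iff]
    have := mul_nonneg (h.pos j).le ht
    linarith
  rw [sampledMean]
  simp only [h.stationaryMean_eq]
  rw [integral_add (integrable_const _) (integrable_finsetSum _ fun j _ => hi j),
    integral_finsetSum _ fun j _ => hi j]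
  simp only [integral_const, probReal_univ, smul_eq_mul, one_mul, integral_const_mul,
    integral_exp_neg_mul_expMeasure hr (h.pos _).le, mul_div_assoc]

end Evaluation

/-! ### A chain with negative coefficients -/

section Example

/-- If all off-diagonal rates are positive then the chain is irreducible. -/
lemma IsGenerator.isIrreducible_of_pos {K : ℕ} {Q : Matrix (Fin K) (Fin K) ℝ}
    (hQ : IsGenerator Q) (h : ∀ i j, i ≠ j → 0 < Q i j) : IsIrreducible Q := by
  intro i j
  rcases eq_or_ne i j with rfl | hij
  · exact ⟨0, le_rfl, by simp [transition_zero]⟩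
  · obtain ⟨c, hc, hle⟩ := hQ.transition_ge zero_le_one
    refine ⟨1, zero_le_one, lt_of_lt_of_le ?_ ((hle i j).2 hij)⟩
    have := h i j hij
    positivity

/-- The rate matrix has entries `9 (π_j - δ_ij)`, so both nonzero eigenvalues are `-9` and `U` may
be any orthogonal matrix with last column `√π`. In general `b_j` is the quadratic form of `P` at the
vector `x_i = √(π_i) u_ij`, negative for suitable `P` that are not positive semidefinite. Here `x =
(2, -4, 2) / 9` has sum `0`, so the all-ones matrix contributes nothing and the two zeros of `P`
leave `-2 x_1 x_3 = -8/81`. -/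
lemma exists_reversible_setup_coef_neg :
    ∃ (n : ℕ) (Q : Matrix (Fin (n + 1)) (Fin (n + 1)) ℝ) (π : Fin (n + 1) → ℝ)
      (U : Matrix (Fin (n + 1)) (Fin (n + 1)) ℝ) (d : Fin n → ℝ)
      (P : Matrix (Fin (n + 1)) (Fin (n + 1)) ℝ), IsReversibleSetup Q π U d P ∧
      ∃ j, coefB π U P j < 0 ∧ coefA π U P d j < 0 := by
  have hQ : IsGenerator !![(-5 : ℝ), 4, 1; 4, -5, 1; 4, 4, -8] := by
    constructor
    · intro i j hij
      fin_cases i <;> fin_cases j <;> simp at hij ⊢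
    · intro i
      fin_cases i <;> simp [Fin.sum_univ_three] <;> norm_num
  have hsqrt : (fun i => √((![4 / 9, 4 / 9, 1 / 9] : Fin 3 → ℝ) i)) = ![2 / 3, 2 / 3, 1 / 3] := by
    have h1 : √(4 / 9 : ℝ) = 2 / 3 := by
      rw [show (4 / 9 : ℝ) = (2 / 3) ^ 2 by norm_num, Real.sqrt_sq (by norm_num)]
    have h2 : √(1 / 9 : ℝ) = 1 / 3 := by
      rw [show (1 / 9 : ℝ) = (1 / 3) ^ 2 by norm_num, Real.sqrt_sq (by norm_num)]
    funext i
    fin_cases i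
    exacts [h1, h1, h2]
  have hsqrt' : (fun i => (√((![4 / 9, 4 / 9, 1 / 9] : Fin 3 → ℝ) i))⁻¹) =
      ![3 / 2, 3 / 2, 3] := by
    funext i
    rw [congrFun hsqrt i]
    fin_cases i <;> norm_num
  have hU : !![(1 / 3 : ℝ), -2 / 3, 2 / 3; -2 / 3, 1 / 3, 2 / 3; 2 / 3, 2 / 3, 1 / 3] ∈
      Matrix.orthogonalGroup (Fin 3) ℝ := by
    rw [Matrix.mem_orthogonalGroup_iff]
    ext i j
    fin_cases i <;> fin_cases j <;>
      norm_num [Matrix.mul_apply, Fin.sum_univ_succ, Matrix.one_apply]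
  have hcoef : coefB ![4 / 9, 4 / 9, 1 / 9]
      !![(1 / 3 : ℝ), -2 / 3, 2 / 3; -2 / 3, 1 / 3, 2 / 3; 2 / 3, 2 / 3, 1 / 3]
      !![1, 1, 0; 1, 1, 1; 0, 1, 1] (0 : Fin 2) = - (8 / 81) := by
    have hπ : ∀ i, 0 < (![4 / 9, 4 / 9, 1 / 9] : Fin 3 → ℝ) i := by
      intro i; fin_cases i <;> norm_num
    rw [coefB_eq_sum, matT_inv hπ hU, matT, hsqrt, hsqrt']
    norm_num [Fin.sum_univ_succ, Matrix.mul_diagonal, Matrix.diagonal_mul]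
  refine ⟨2, !![-5, 4, 1; 4, -5, 1; 4, 4, -8], ![4 / 9, 4 / 9, 1 / 9],
    !![1 / 3, -2 / 3, 2 / 3; -2 / 3, 1 / 3, 2 / 3; 2 / 3, 2 / 3, 1 / 3], ![9, 9],
    !![1, 1, 0; 1, 1, 1; 0, 1, 1], ⟨hQ, hQ.isIrreducible_of_pos ?_, ⟨?_, ?_, ?_⟩, ?_, ⟨hU, ?_⟩,
      ⟨?_, ?_, ?_⟩⟩, 0, ?_, ?_⟩
  · intro i j hij
    fin_cases i <;> fin_cases j <;> simp at hij ⊢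
  · intro i; fin_cases i <;> norm_num
  · norm_num [Fin.sum_univ_succ]
  · funext j
    fin_cases j <;> norm_num [Matrix.vecMul, dotProduct, Fin.sum_univ_succ]
  · intro i j hij
    fin_cases i <;> fin_cases j <;> simp at hij ⊢ <;> norm_num
  · rw [symmetrized, hsqrt, hsqrt']
    ext i j
    fin_cases i <;> fin_cases j <;>
      norm_num [Matrix.mul_apply, Fin.sum_univ_succ, Matrix.diagonal_apply, Fin.snoc, Fin.castLT]
  · intro i j
    fin_cases i <;> fin_cases j <;> norm_num
  · intro i j
    fin_cases i <;> fin_cases j <;> norm_num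
  · intro i
    fin_cases i <;> norm_num
  · rw [hcoef]; norm_num
  · rw [coefA, hcoef]; norm_num

end Example

end Freshness

theorem corollary3 :
    (∀ (n : ℕ) (Q : Matrix (Fin (n + 1)) (Fin (n + 1)) ℝ) (π : Fin (n + 1) → ℝ)
      (U : Matrix (Fin (n + 1)) (Fin (n + 1)) ℝ) (d : Fin n → ℝ)
      (P : Matrix (Fin (n + 1)) (Fin (n + 1)) ℝ), IsReversibleSetup Q π U d P →
      ∃ f : ℝ → ℝ,
        (∀ r : ℝ, 0 < r →
          ∀ (Ω : Type*) [MeasurableSpace Ω] (μ : Measure Ω) [IsProbabilityMeasure μ]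
            (X : ℝ≥0 → Ω → Fin (n + 1)) (N : ℝ≥0 → Ω → ℕ),
            IsPoissonSampledCTMC μ Q r X N → IsMeanFreshness μ (fwc P X N) (f r)) ∧
        (∀ r : ℝ, 0 < r →
          f r = π ⬝ᵥ (∑ i, π i • P.col i) + ∑ j, coefB π U P j * r / (r + d j)) ∧
        (∀ r : ℝ, 0 < r → f r = 1 - ∑ j, coefA π U P d j / (r + d j)) ∧
        Tendsto f (𝓝[>] 0) (𝓝 (π ⬝ᵥ (∑ i, π i • P.col i)))) ∧
    (∃ (n : ℕ) (Q : Matrix (Fin (n + 1)) (Fin (n + 1)) ℝ) (π : Fin (n + 1) → ℝ)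
      (U : Matrix (Fin (n + 1)) (Fin (n + 1)) ℝ) (d : Fin n → ℝ)
      (P : Matrix (Fin (n + 1)) (Fin (n + 1)) ℝ), IsReversibleSetup Q π U d P ∧
      ∃ j, coefB π U P j < 0 ∧ coefA π U P d j < 0) := by
  refine ⟨fun n Q π U d P h => ?_, exists_reversible_setup_coef_neg⟩
  refine ⟨fun r => π ⬝ᵥ (∑ i, π i • P.col i) + ∑ j, coefB π U P j * r / (r + d j), ?_,
    fun _ _ => rfl, fun r hr => ?_, ?_⟩
  · intro r hr Ω _ μ _ X N hXN
    obtain ⟨C, c, hC, hc, hmix⟩ := h.diagonalization.exists_abs_transition_sub_le h.generator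
      h.irreducible h.stationary
    dsimp only
    rw [← h.sampledMean_eq hr]
    exact hXN.isMeanFreshness h.generator h.stationary hr hC.le hc hmix h.proximity
  · dsimp only
    -- Termwise, `b_j r / (r + d_j) = b_j - a_j / (r + d_j)`, and the constant together with all the
    -- `b_j` adds up to `1`.
    rw [← h.sum_eq_one, add_sub_assoc, ← Finset.sum_sub_distrib]
    congr 1
    refine Finset.sum_congr rfl fun j _ => ?_
    have := h.pos j
    rw [coefA]
    field_simp
    ring
  -- Positivity of the `d_j` keeps the denominators nonzero at `r = 0`, where each summand vanishes.
  · have hcont : ContinuousAt (fun r : ℝ => π ⬝ᵥ (∑ i, π i • P.col i) +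
        ∑ j, coefB π U P j * r / (r + d j)) 0 := by
      refine continuousAt_const.add (tendsto_finsetSum _ fun j _ => ?_)
      exact ContinuousAt.div (by fun_prop) (by fun_prop) (by simpa using (h.pos j).ne')
    have := hcont.tendsto.mono_left (nhdsWithin_le_nhds (s := Set.Ioi 0))
    simpa using this
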